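/- Let $n\ge 1$, $s\in\mathbb R$, $1\le p,q\le\infty$, and let $q'$ be the conjugate exponent, $\frac1q+\frac1{q'}=1$. Fix any window $\phi\in\mathcal S(\mathbb R^n)$, $\phi\ne 0$. For a tempered distribution $f\in\mathcal S'(\mathbb R^n)$ let $$V_\phi f(x,\xi)=(2\pi)^{-n/2}\int_{\mathbb R^n} f(t)\,\overline{\phi(t-x)}\,e^{-it\cdot\xi}\,dt,\qquad x,\xi\in\mathbb R^n,$$ be its short-time Fourier transform (the integral is read as the pairing of $f$ with a Schwartz function). Let $\langle\xi\rangle=(1+|\xi|^2)^{1/2}$, and let $M^s_{p,q}$ be the space of all $f\in\mathcal S'(\mathbb R^n)$ with $$\|f\|_{M^s_{p,q}}=\Big(\int_{\mathbb R^n}\Big(\int_{\mathbb R^n}|V_\phi f(x,\xi)\,\langle\xi\rangle^s|^p\,dx\Big)^{q/p}d\xi\Big)^{1/q}<\infty$$ (with the usual modifications if $p=\infty$ or $q=\infty$). Let $L_\infty=L_\infty(\mathbb R^n)$, and let $C_{ub}$ be the space of all bounded uniformly continuous functions $\mathbb R^n\to\mathbb C$ with the supremum norm; both are regarded as subspaces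 of $\mathcal S'(\mathbb R^n)$, and $X\hookrightarrow Y$ means that $X\subseteq Y$ with continuous inclusion. Then the following assertions are equivalent: 1. $M^s_{p,q}\hookrightarrow L_\infty$; 2. $M^s_{p,q}\hookrightarrow C_{ub}$; 3. $M^s_{p,q}\hookrightarrow M^0_{\infty,1}$; 4. either $s\ge 0$ and $q=1$, or $s>n/q'$. -/

import Mathlib

open MeasureTheory Function
open scoped ENNReal NNReal SchwartzMap BoundedContinuousFunction

noncomputable section

namespace ModulationSpace

/-- Points of the Euclidean space `ℝⁿ`. -/
abbrev Rn (n : ℕ) : Type := EuclideanSpace ℝ (Fin n)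

variable {n : ℕ}

/-- The unimodular function `r ↦ e^{-i r}` on `ℝ` has temperate growth. -/
theorem hasTemperateGrowth_cexp :
    HasTemperateGrowth (fun r : ℝ => Complex.exp (-Complex.I * (r : ℂ))) := by
  have hd : ∀ r : ℝ, HasDerivAt (fun r : ℝ => Complex.exp (-Complex.I * (r : ℂ)))
      ((-Complex.I) * Complex.exp (-Complex.I * (r : ℂ))) r := by
    intro r
    have h1 : HasDerivAt (fun r : ℝ => -Complex.I * (r : ℂ)) (-Complex.I) r := by
      simpa using (Complex.ofRealCLM.hasDerivAt (x := r)).const_mul (-Complex.I)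
    simpa [mul_comm] using h1.cexp
  have hi : ∀ m : ℕ, iteratedDeriv m (fun r : ℝ => Complex.exp (-Complex.I * (r : ℂ)))
      = fun r : ℝ => (-Complex.I) ^ m * Complex.exp (-Complex.I * (r : ℂ)) := by
    intro m
    induction m with
    | zero => simp
    | succ m ih =>
      rw [iteratedDeriv_succ, ih]
      funext r
      rw [((hd r).const_mul ((-Complex.I) ^ m)).deriv]
      ring
  refine ⟨?_, fun m => ⟨0, 1, fun r => ?_⟩⟩
  · exact (contDiff_const.mul Complex.ofRealCLM.contDiff).cexp
  · rw [norm_iteratedFDeriv_eq_norm_iteratedDeriv, hi m]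
    simp [Complex.norm_exp]

/-- For fixed `ξ`, the exponential `t ↦ e^{-i t·ξ}` on `ℝⁿ` has temperate growth. -/
theorem hasTemperateGrowth_wave (ξ : Rn n) :
    HasTemperateGrowth (fun t : Rn n => Complex.exp (-Complex.I * ((inner ℝ t ξ : ℝ) : ℂ))) :=
  hasTemperateGrowth_cexp.comp (hasTemperateGrowth_inner_left ξ)

/-- The Schwartz function `t ↦ e^{-i t·ξ} · conj (φ (t - x))`. -/
def shiftedWindow (φ : 𝓢(Rn n, ℂ)) (x ξ : Rn n) : 𝓢(Rn n, ℂ) :=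
  SchwartzMap.smulLeftCLM ℂ (fun t : Rn n => Complex.exp (-Complex.I * ((inner ℝ t ξ : ℝ) : ℂ)))
    (SchwartzMap.postcompCLM (𝕜 := ℝ) (Complex.conjCLE : ℂ →L[ℝ] ℂ)
      (SchwartzMap.compSubConstCLM ℝ x φ))

theorem shiftedWindow_apply (φ : 𝓢(Rn n, ℂ)) (x ξ t : Rn n) :
    shiftedWindow φ x ξ t =
      Complex.exp (-Complex.I * ((inner ℝ t ξ : ℝ) : ℂ)) * (starRingEnd ℂ) (φ (t - x)) := by
  rw [shiftedWindow, SchwartzMap.smulLeftCLM_apply_apply (hasTemperateGrowth_wave ξ)]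
  simp

/-- The short-time Fourier transform of a tempered distribution `f` with window `φ`,
`V_φ f (x, ξ) = (2π)^{-n/2} ∫ f(t) conj (φ (t - x)) e^{-i t·ξ} dt`,
the integral being the duality pairing of `f` with a Schwartz function. -/
def stft (φ : 𝓢(Rn n, ℂ)) (f : 𝓢'(Rn n, ℂ)) (x ξ : Rn n) : ℂ :=
  (((2 * Real.pi) ^ (-(n : ℝ) / 2) : ℝ) : ℂ) * f (shiftedWindow φ x ξ)

/-- The weighted modulation norm `‖f‖_{M^s_{p,q}}` with respect to the window `φ`: the `L^p` norm
of `V_φ f (x, ξ) ⟨ξ⟩^s` in `x`, followed by the `L^q` norm in `ξ`, where `⟨ξ⟩ = (1 + |ξ|²)^{1/2}`.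
It takes the value `∞` exactly on the tempered distributions outside `M^s_{p,q}`. -/
def modNorm (φ : 𝓢(Rn n, ℂ)) (s : ℝ) (p q : ℝ≥0∞) (f : 𝓢'(Rn n, ℂ)) : ℝ≥0∞ :=
  eLpNorm (fun ξ : Rn n =>
    eLpNorm (fun x : Rn n => ((Real.sqrt (1 + ‖ξ‖ ^ 2)) ^ s : ℝ) • stft φ f x ξ) p volume)
    q volume

/-- The norm of `L_∞(ℝⁿ)` on tempered distributions: the essential supremum norm of the
(unique) function in `L_∞` representing `f`, and `∞` if there is no such function. -/
def linftyNorm (f : 𝓢'(Rn n, ℂ)) : ℝ≥0∞ :=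
  ⨅ (g : Lp ℂ ∞ (volume : Measure (Rn n))) (_ : (g : 𝓢'(Rn n, ℂ)) = f), ‖g‖ₑ

/-- The norm of `C_{ub}(ℝⁿ)` on tempered distributions: the supremum norm of the (unique) bounded
uniformly continuous function representing `f`, and `∞` if there is no such function. -/
def cubNorm (f : 𝓢'(Rn n, ℂ)) : ℝ≥0∞ :=
  ⨅ (g : Rn n →ᵇ ℂ) (_ : UniformContinuous g)
    (_ : ∀ u : 𝓢(Rn n, ℂ), f u = ∫ x, g x * u x), ‖g‖ₑ

/-- `X ↪ Y` for normed spaces `X`, `Y` of tempered distributions. Each is given by its norm,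
extended by the value `∞` outside the space: every `f ∈ X` lies in `Y` and the inclusion is
bounded, i.e. continuous. -/
def ContinuouslyEmbeds (normX normY : 𝓢'(Rn n, ℂ) → ℝ≥0∞) : Prop :=
  ∃ C : ℝ≥0, ∀ f : 𝓢'(Rn n, ℂ), normX f < ∞ → normY f ≤ C * normX f

end ModulationSpace

end

/-! Sufficiency rests on a reproducing formula. Integrating the short-time Fourier transform (STFT)
of a Schwartz function `u` against the shifted windows gives back `u` up to a positive constant
(`integral_crossSTFT_mul_shiftedWindow`). A tempered distribution may be applied under this integral
(`SchwartzMap.map_eq_integral`), so `V_φ f` equals an integral of itself against a kernel decaying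
rapidly in `y - x` and `ξ - η`. Hölder in `y` then bounds `|V_φ f (x, ξ)|` by a convolution in `ξ`
of an integrable weight with the `L^p` norms of `V_φ f (·, η)` (`exists_enorm_stft_le`). Hence the
`M^0_{∞,1}` norm is at most a multiple of the integral of these `L^p` norms. A second Hölder
inequality, now in frequency, bounds that integral by the `M^s_{p,q}` norm as soon as `⟨ξ⟩^{-s}`
lies in `L^{q'}`, which assertion 4 guarantees.

For `f` in `M^0_{∞,1}` the synthesis integral converges absolutely, represents `f`, and is bounded
and uniformly continuous by dominated convergence (`exists_cubNorm_le`). The step from `C_{ub}` to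
`L_∞` is immediate.

Necessity uses the functions `g_r(t) = ψ(t) ∫ e^{i t·η} ⟨η⟩^{-r} dη` with `ψ(0) = 1` and `n < r ≤ n
+ 1`. Put `I(r) = ∫ ⟨η⟩^{-r} dη`, which is unbounded as `r` decreases to `n`. The supremum of
`|g_r|` is at least `g_r(0) = I(r)`, while the `M^s_{p,q}` norm is at most `C ‖⟨ξ⟩^{s-r}‖_q` with
`C` independent of `r`. If `s ≤ n/q'`, this is at most `C I(r)^{1/q}`, so an embedding into `L_∞`
would bound `I(r)` whenever `q > 1`. If `q = 1` and `s < 0`, the modulation norms stay bounded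
outright. -/

noncomputable section

/-! ### Continuous functionals on the Schwartz space commute with integrals -/

namespace SchwartzMap

variable {E : Type*} [NormedAddCommGroup E] [NormedSpace ℝ E]

/-- Real multilinear forms of degree `l` on `E` with values in `ℂ`. -/
def MultilinearForm (E : Type*) [NormedAddCommGroup E] [NormedSpace ℝ E] (l : ℕ) : Type _ :=
  E [×l]→L[ℝ] ℂ

namespace MultilinearForm

instance (l : ℕ) : NormedAddCommGroup (MultilinearForm E l) :=
  inferInstanceAs (NormedAddCommGroup (E [×l]→L[ℝ] ℂ))

instance (l : ℕ) : NormedSpace ℝ (MultilinearForm E l) :=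
  inferInstanceAs (NormedSpace ℝ (E [×l]→L[ℝ] ℂ))

instance (l : ℕ) : NormedSpace ℂ (MultilinearForm E l) :=
  inferInstanceAs (NormedSpace ℂ (E [×l]→L[ℝ] ℂ))

instance (l : ℕ) : CompleteSpace (MultilinearForm E l) :=
  inferInstanceAs (CompleteSpace (E [×l]→L[ℝ] ℂ))

instance (l : ℕ) : SMulCommClass ℝ ℂ (MultilinearForm E l) :=
  inferInstanceAs (SMulCommClass ℝ ℂ (E [×l]→L[ℝ] ℂ))

end MultilinearForm

/-- The `l`-th derivative of a Schwartz function at `x`. -/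
def derivForm (l : ℕ) (u : 𝓢(E, ℂ)) (x : E) : MultilinearForm E l := iteratedFDeriv ℝ l u x

theorem continuous_derivForm (l : ℕ) (u : 𝓢(E, ℂ)) : Continuous (derivForm l u) :=
  (u.smooth l).continuous_iteratedFDeriv le_rfl

theorem norm_derivForm (l : ℕ) (u : 𝓢(E, ℂ)) (x : E) :
    ‖derivForm l u x‖ = ‖iteratedFDeriv ℝ l u x‖ := rfl

theorem derivForm_add (l : ℕ) (u v : 𝓢(E, ℂ)) (x : E) :
    derivForm l (u + v) x = derivForm l u x + derivForm l v x :=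
  iteratedFDeriv_add_apply (u.smooth l).contDiffAt (v.smooth l).contDiffAt

theorem derivForm_smul (l : ℕ) (a : ℂ) (u : 𝓢(E, ℂ)) (x : E) :
    derivForm l (a • u) x = a • derivForm l u x :=
  iteratedFDeriv_const_smul_apply (u.smooth l).contDiffAt

/-- The bounded continuous function `x ↦ ‖x‖ ^ k • D^l u(x)` attached to a Schwartz function. -/
def weightedDerivBCF (k l : ℕ) (u : 𝓢(E, ℂ)) : E →ᵇ MultilinearForm E l :=
  BoundedContinuousFunction.ofNormedAddCommGroup (fun x => (‖x‖ ^ k) • derivForm l u x)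
    ((continuous_norm.pow k).smul (continuous_derivForm l u))
    (SchwartzMap.seminorm ℝ k l u) (fun x => by
      rw [norm_smul, norm_pow, norm_norm]; exact SchwartzMap.le_seminorm ℝ k l u x)

theorem weightedDerivBCF_apply (k l : ℕ) (u : 𝓢(E, ℂ)) (x : E) :
    weightedDerivBCF k l u x = (‖x‖ ^ k) • derivForm l u x := rfl

theorem norm_weightedDerivBCF (k l : ℕ) (u : 𝓢(E, ℂ)) :
    ‖weightedDerivBCF k l u‖ = SchwartzMap.seminorm ℝ k l u := by
  refine le_antisymm
    (BoundedContinuousFunction.norm_ofNormedAddCommGroup_le _ (apply_nonneg _ _) _) ?_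
  refine SchwartzMap.seminorm_le_bound ℝ k l u (norm_nonneg _) fun x => ?_
  have := (weightedDerivBCF k l u).norm_coe_le_norm x
  rwa [weightedDerivBCF_apply, norm_smul, norm_pow, norm_norm] at this

/-- `SchwartzMap.weightedDerivBCF` as a continuous linear map. -/
def weightedDerivCLM (k l : ℕ) : 𝓢(E, ℂ) →L[ℂ] (E →ᵇ MultilinearForm E l) :=
  SchwartzMap.mkCLMtoNormedSpace (weightedDerivBCF k l)
    (fun u v => by
      ext1 x
      simp only [BoundedContinuousFunction.add_apply, weightedDerivBCF_apply, derivForm_add,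
        smul_add])
    (fun a u => by
      ext1 x
      simp only [BoundedContinuousFunction.smul_apply, weightedDerivBCF_apply, derivForm_smul,
        RingHom.id_apply, smul_comm a])
    ⟨{(k, l)}, 1, zero_le_one, fun u => by
      rw [Finset.sup_singleton, one_mul]
      exact (norm_weightedDerivBCF k l u).le⟩

theorem weightedDerivCLM_apply (k l : ℕ) (u : 𝓢(E, ℂ)) (x : E) :
    weightedDerivCLM k l u x = (‖x‖ ^ k) • derivForm l u x := rfl

theorem norm_weightedDerivCLM (k l : ℕ) (u : 𝓢(E, ℂ)) :
    ‖weightedDerivCLM k l u‖ = SchwartzMap.seminorm ℝ k l u :=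
  norm_weightedDerivBCF k l u

variable {W : Type*} [TopologicalSpace W] [SecondCountableTopology W] [MeasurableSpace W]
  [OpensMeasurableSpace W] {μ : Measure W}

theorem integrable_derivForm {Φ : W → 𝓢(E, ℂ)} (hΦ : Continuous Φ)
    (hint : ∀ k l, Integrable (fun w => SchwartzMap.seminorm ℝ k l (Φ w)) μ) (l : ℕ) (x : E) :
    Integrable (fun w => derivForm l (Φ w) x) μ := by
  have hc : Continuous fun w => derivForm l (Φ w) x := by
    have h : Continuous fun w => (weightedDerivCLM 0 l (Φ w)) x :=
      (BoundedContinuousFunction.lipschitz_eval_const x).continuous.comp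
        ((weightedDerivCLM 0 l).continuous.comp hΦ)
    simpa [weightedDerivCLM_apply] using h
  refine (hint 0 l).mono' hc.aestronglyMeasurable (.of_forall fun w => ?_)
  exact SchwartzMap.norm_iteratedFDeriv_le_seminorm ℝ (Φ w) l x

/-- The currying isomorphism for multilinear forms. -/
def MultilinearForm.uncurry (E : Type*) [NormedAddCommGroup E] [NormedSpace ℝ E] (l : ℕ) :
    (E →L[ℝ] MultilinearForm E l) ≃L[ℝ] MultilinearForm E (l + 1) :=
  (continuousMultilinearCurryLeftEquiv ℝ (fun _ : Fin (l + 1) => E) ℂ).symm.toContinuousLinearEquiv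

/-- Numbers as multilinear forms of degree zero. -/
def MultilinearForm.ofComplex (E : Type*) [NormedAddCommGroup E] [NormedSpace ℝ E] :
    ℂ ≃L[ℝ] MultilinearForm E 0 :=
  (continuousMultilinearCurryFin0 ℝ E ℂ).symm.toContinuousLinearEquiv

theorem derivForm_zero (u : 𝓢(E, ℂ)) (x : E) :
    derivForm 0 u x = MultilinearForm.ofComplex E (u x) := rfl

theorem derivForm_succ (l : ℕ) (u : 𝓢(E, ℂ)) (x : E) :
    derivForm (l + 1) u x = MultilinearForm.uncurry E l (fderiv ℝ (derivForm l u) x) := by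
  rw [derivForm, iteratedFDeriv_succ_eq_comp_left]; rfl

theorem norm_fderiv_derivForm (l : ℕ) (u : 𝓢(E, ℂ)) (x : E) :
    ‖fderiv ℝ (derivForm l u) x‖ = ‖derivForm (l + 1) u x‖ :=
  norm_fderiv_iteratedFDeriv

theorem differentiable_derivForm (l : ℕ) (u : 𝓢(E, ℂ)) : Differentiable ℝ (derivForm l u) :=
  (u.smooth ⊤).differentiable_iteratedFDeriv (by exact_mod_cast WithTop.coe_lt_top l)

/-- Induction on `l` by differentiating under the integral sign: the next derivative is dominated,
uniformly in the point, by the integrable seminorm of index `(0, l + 1)`. -/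
theorem derivForm_eq_integral {Φ : W → 𝓢(E, ℂ)} (hΦ : Continuous Φ)
    (hint : ∀ k l, Integrable (fun w => SchwartzMap.seminorm ℝ k l (Φ w)) μ) {g : 𝓢(E, ℂ)}
    (hg : ∀ x, g x = ∫ w, Φ w x ∂μ) (l : ℕ) (x : E) :
    derivForm l g x = ∫ w, derivForm l (Φ w) x ∂μ := by
  induction l generalizing x with
  | zero =>
    simp only [derivForm_zero]
    rw [ContinuousLinearEquiv.integral_comp_comm, hg]
  | succ l ih =>
    have hd : HasFDerivAt (derivForm l g)
        (∫ w, fderiv ℝ (derivForm l (Φ w)) x ∂μ) x := by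
      have : derivForm l g = fun x => ∫ w, derivForm l (Φ w) x ∂μ := funext ih
      rw [this]
      refine hasFDerivAt_integral_of_dominated_of_fderiv_le (s := Set.univ)
        (F' := fun y w => fderiv ℝ (derivForm l (Φ w)) y)
        (bound := fun w => SchwartzMap.seminorm ℝ 0 (l + 1) (Φ w)) Filter.univ_mem
        (.of_forall fun y => (integrable_derivForm hΦ hint l y).1)
        (integrable_derivForm hΦ hint l x) ?_ (.of_forall fun w y _ => ?_)
        (hint 0 (l + 1)) (.of_forall fun w y _ => ?_)
      · have h := (MultilinearForm.uncurry E l).symm.continuous.comp_aestronglyMeasurable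
          (integrable_derivForm hΦ hint (l + 1) x).1
        simpa only [derivForm_succ, ContinuousLinearEquiv.symm_apply_apply] using h
      · rw [norm_fderiv_derivForm]
        exact SchwartzMap.norm_iteratedFDeriv_le_seminorm ℝ (Φ w) (l + 1) y
      · exact (differentiable_derivForm l (Φ w) y).hasFDerivAt
    simp only [derivForm_succ]
    rw [hd.fderiv, ContinuousLinearEquiv.integral_comp_comm]

/-- A linear functional dominated by finitely many continuous linear maps into Banach spaces
commutes with every integral with which all these maps commute. -/
theorem _root_.ContinuousLinearMap.map_eq_integral_of_norm_le {S X ι : Type*} [AddCommGroup S]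
    [Module ℂ S] [TopologicalSpace S] [Fintype ι] {B : ι → Type*}
    [∀ i, NormedAddCommGroup (B i)] [∀ i, NormedSpace ℂ (B i)] [∀ i, CompleteSpace (B i)]
    [MeasurableSpace X] {ν : Measure X} (T : ∀ i, S →L[ℂ] B i) (f : S →L[ℂ] ℂ) {C : ℝ}
    (hf : ∀ u, ‖f u‖ ≤ C * ‖fun i => T i u‖) {Φ : X → S} {g : S}
    (hint : ∀ i, Integrable (fun x => T i (Φ x)) ν) (hg : ∀ i, T i g = ∫ x, T i (Φ x) ∂ν) :
    f g = ∫ x, f (Φ x) ∂ν := by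
  -- The bound makes `f` vanish on the kernel of the joint map, so `f` descends to a bounded
  -- functional on its range. Hahn–Banach extends this to the whole product of Banach spaces, where
  -- a continuous functional commutes with the Bochner integral.
  let ι : S →L[ℂ] (∀ i, B i) := ContinuousLinearMap.pi T
  have hker : LinearMap.ker ι.toLinearMap ≤ LinearMap.ker f.toLinearMap := fun u hu => by
    have h0 : (fun i => T i u) = 0 := hu
    have := hf u
    rw [h0, norm_zero, mul_zero] at this
    exact norm_le_zero_iff.1 this
  let f₀ : LinearMap.range ι.toLinearMap →ₗ[ℂ] ℂ :=
    ((LinearMap.ker ι.toLinearMap).liftQ f.toLinearMap hker).comp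
      (ι.toLinearMap.quotKerEquivRange.symm).toLinearMap
  have hf₀ (u : S) : f₀ ⟨ι u, ⟨u, rfl⟩⟩ = f u := by
    have : ι.toLinearMap.quotKerEquivRange.symm ⟨ι u, ⟨u, rfl⟩⟩ = Submodule.Quotient.mk u := by
      rw [LinearEquiv.symm_apply_eq]; rfl
    simp only [f₀, LinearMap.comp_apply, LinearEquiv.coe_coe]
    rw [this]; rfl
  let f₁ : StrongDual ℂ (LinearMap.range ι.toLinearMap) := f₀.mkContinuous C (by
    rintro ⟨_, u, rfl⟩
    exact (congrArg norm (hf₀ u)).le.trans (hf u))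
  obtain ⟨F, hF, -⟩ := exists_extension_norm_eq _ f₁
  have hFι (u : S) : F (ι u) = f u := (hF ⟨ι u, ⟨u, rfl⟩⟩).trans (hf₀ u)
  have hιΦ : Integrable (fun x => ι (Φ x)) ν := Integrable.of_eval hint
  have hJ : ι g = ∫ x, ι (Φ x) ∂ν := by
    funext i
    rw [MeasureTheory.eval_integral fun j => hιΦ.eval j]
    exact hg i
  rw [← hFι, hJ, ← F.integral_comp_comm hιΦ]
  simp only [hFι]

theorem integrable_weightedDerivCLM {Φ : W → 𝓢(E, ℂ)} (hΦ : Continuous Φ)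
    (hint : ∀ k l, Integrable (fun w => SchwartzMap.seminorm ℝ k l (Φ w)) μ) (k l : ℕ) :
    Integrable (fun w => weightedDerivCLM k l (Φ w)) μ :=
  (hint k l).mono' ((weightedDerivCLM k l).continuous.comp hΦ).aestronglyMeasurable
    (.of_forall fun w => (norm_weightedDerivCLM k l (Φ w)).le)

/-- Point evaluations separate bounded continuous functions and commute with the Bochner integral,
so the pointwise identity for derivatives is enough. -/
theorem weightedDerivCLM_eq_integral {Φ : W → 𝓢(E, ℂ)} (hΦ : Continuous Φ)
    (hint : ∀ k l, Integrable (fun w => SchwartzMap.seminorm ℝ k l (Φ w)) μ) {g : 𝓢(E, ℂ)}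
    (hg : ∀ x, g x = ∫ w, Φ w x ∂μ) (k l : ℕ) :
    weightedDerivCLM k l g = ∫ w, weightedDerivCLM k l (Φ w) ∂μ := by
  refine BoundedContinuousFunction.ext fun x => ?_
  have hev := ((BoundedContinuousFunction.evalCLM ℝ x).integral_comp_comm
    (integrable_weightedDerivCLM hΦ hint k l))
  refine Eq.trans ?_ hev
  change (‖x‖ ^ k) • derivForm l g x = ∫ w, (‖x‖ ^ k) • derivForm l (Φ w) x ∂μ
  rw [integral_smul, derivForm_eq_integral hΦ hint hg]

/-- A continuous functional on the Schwartz space commutes with the integral of a continuous family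
of Schwartz functions whose seminorms are integrable. -/
theorem map_eq_integral {Φ : W → 𝓢(E, ℂ)} (hΦ : Continuous Φ)
    (hint : ∀ k l, Integrable (fun w => SchwartzMap.seminorm ℝ k l (Φ w)) μ) {g : 𝓢(E, ℂ)}
    (hg : ∀ x, g x = ∫ w, Φ w x ∂μ) (f : 𝓢(E, ℂ) →L[ℂ] ℂ) :
    f g = ∫ w, f (Φ w) ∂μ := by
  -- Continuity of `f` means domination by finitely many Schwartz seminorms, and each of them is the
  -- norm of a `weightedDerivCLM`.
  obtain ⟨s, C, -, hC⟩ := Seminorm.bound_of_continuous (schwartz_withSeminorms ℝ E ℂ)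
    ((normSeminorm ℝ ℂ).comp (f.toLinearMap.restrictScalars ℝ))
    (continuous_norm.comp f.continuous)
  refine ContinuousLinearMap.map_eq_integral_of_norm_le (ι := s) (C := C)
    (fun i => weightedDerivCLM i.1.1 i.1.2) f (fun u => ?_)
    (fun i => integrable_weightedDerivCLM hΦ hint _ _)
    (fun i => weightedDerivCLM_eq_integral hΦ hint hg _ _)
  refine (hC u).trans ?_
  rw [smul_apply, NNReal.smul_def, smul_eq_mul]
  refine mul_le_mul_of_nonneg_left ?_ C.2
  refine Seminorm.finset_sup_apply_le (norm_nonneg _) fun i hi => ?_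
  refine (norm_weightedDerivCLM i.1 i.2 u).symm.le.trans ?_
  exact norm_le_pi_norm (fun i : s => weightedDerivCLM i.1.1 i.1.2 u) ⟨i, hi⟩

end SchwartzMap

/-! ### Translations of Schwartz functions: continuity and polynomial growth -/

namespace SchwartzMap

variable {E : Type*} [NormedAddCommGroup E] [NormedSpace ℝ E]

theorem derivForm_compSubConst (l : ℕ) (u : 𝓢(E, ℂ)) (a x : E) :
    derivForm l (compSubConstCLM ℝ a u) x = derivForm l u (x - a) :=
  iteratedFDeriv_comp_sub (f := u) l a x

theorem derivForm_sub (l : ℕ) (u v : 𝓢(E, ℂ)) (x : E) :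
    derivForm l (u - v) x = derivForm l u x - derivForm l v x := by
  rw [eq_sub_iff_add_eq, ← derivForm_add, sub_add_cancel]

/-- Because `‖x‖ ≤ (1 + ‖a‖)(‖x - a‖ + 1)`, a translation by `a` costs only a factor polynomial in
`‖a‖`. -/
theorem norm_pow_mul_derivForm_sub_le (k l : ℕ) (u : 𝓢(E, ℂ)) (a x : E) :
    ‖x‖ ^ k * ‖derivForm l u (x - a)‖ ≤ 2 ^ k * (1 + ‖a‖) ^ k *
      (SchwartzMap.seminorm ℝ k l u + SchwartzMap.seminorm ℝ 0 l u) := by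
  have h1 : ‖x‖ ≤ (1 + ‖a‖) * (‖x - a‖ + 1) := by
    have := norm_add_le (x - a) a
    rw [sub_add_cancel] at this
    nlinarith [norm_nonneg a, norm_nonneg (x - a), mul_nonneg (norm_nonneg a) (norm_nonneg (x - a))]
  have h2 : (‖x - a‖ + 1) ^ k ≤ 2 ^ k * (‖x - a‖ ^ k + 1) := by
    have := add_pow_le (norm_nonneg (x - a)) zero_le_one k
    rw [one_pow] at this
    refine this.trans (mul_le_mul_of_nonneg_right ?_ (by positivity))
    exact pow_le_pow_right₀ one_le_two (Nat.sub_le _ _)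
  have h3 := SchwartzMap.le_seminorm ℝ k l u (x - a)
  have h4 := SchwartzMap.norm_iteratedFDeriv_le_seminorm ℝ u l (x - a)
  rw [← norm_derivForm] at h3 h4
  calc ‖x‖ ^ k * ‖derivForm l u (x - a)‖
      ≤ ((1 + ‖a‖) * (‖x - a‖ + 1)) ^ k * ‖derivForm l u (x - a)‖ := by gcongr
    _ = (1 + ‖a‖) ^ k * ((‖x - a‖ + 1) ^ k * ‖derivForm l u (x - a)‖) := by rw [mul_pow]; ring
    _ ≤ (1 + ‖a‖) ^ k * ((2 ^ k * (‖x - a‖ ^ k + 1)) * ‖derivForm l u (x - a)‖) := by gcongr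
    _ = 2 ^ k * (1 + ‖a‖) ^ k *
        (‖x - a‖ ^ k * ‖derivForm l u (x - a)‖ + ‖derivForm l u (x - a)‖) := by ring
    _ ≤ _ := by gcongr

theorem seminorm_compSubConst_le (k l : ℕ) (u : 𝓢(E, ℂ)) (a : E) :
    SchwartzMap.seminorm ℝ k l (compSubConstCLM ℝ a u) ≤ 2 ^ k * (1 + ‖a‖) ^ k *
      (SchwartzMap.seminorm ℝ k l u + SchwartzMap.seminorm ℝ 0 l u) := by
  refine SchwartzMap.seminorm_le_bound ℝ k l _ (by positivity) fun x => ?_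
  rw [← norm_derivForm, derivForm_compSubConst]
  exact norm_pow_mul_derivForm_sub_le k l u a x

/-- Mean value inequality in the translation parameter along the segment from `a` to `b`, at the
price of one more derivative. -/
theorem seminorm_compSubConst_sub_le (k l : ℕ) (u : 𝓢(E, ℂ)) (a b : E) :
    SchwartzMap.seminorm ℝ k l (compSubConstCLM ℝ a u - compSubConstCLM ℝ b u) ≤
      2 ^ k * (1 + (‖a‖ + ‖b‖)) ^ k *
      (SchwartzMap.seminorm ℝ k (l + 1) u + SchwartzMap.seminorm ℝ 0 (l + 1) u) * ‖a - b‖ := by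
  refine SchwartzMap.seminorm_le_bound ℝ k l _ (by positivity) fun x => ?_
  rw [← norm_derivForm, derivForm_sub, derivForm_compSubConst, derivForm_compSubConst]
  have hseg : ∀ z ∈ segment ℝ a b, ‖z‖ ≤ ‖a‖ + ‖b‖ := by
    rintro z ⟨s, t, hs, ht, hst, rfl⟩
    refine (norm_add_le _ _).trans ?_
    rw [norm_smul, norm_smul, Real.norm_of_nonneg hs, Real.norm_of_nonneg ht]
    nlinarith [norm_nonneg a, norm_nonneg b]
  have := (convex_segment a b).norm_image_sub_le_of_norm_hasFDerivWithin_le (𝕜 := ℝ)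
    (f := fun z => (‖x‖ ^ k) • derivForm l u (x - z))
    (f' := fun z => (‖x‖ ^ k) • -(fderiv ℝ (derivForm l u) (x - z)))
    (C := 2 ^ k * (1 + (‖a‖ + ‖b‖)) ^ k *
      (SchwartzMap.seminorm ℝ k (l + 1) u + SchwartzMap.seminorm ℝ 0 (l + 1) u)) (fun z _ => ?_)
    (fun z hz => ?_) (right_mem_segment ℝ a b) (left_mem_segment ℝ a b)
  · rwa [← smul_sub, norm_smul, norm_pow, norm_norm] at this
  · have h := ((differentiable_derivForm l u (x - z)).hasFDerivAt.comp z
      ((hasFDerivAt_id z).const_sub x)).const_smul (‖x‖ ^ k)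
    refine HasFDerivAt.hasFDerivWithinAt ?_
    convert! h using 1
    ext v
    simp
  · rw [norm_smul, norm_neg, norm_pow, norm_norm, norm_fderiv_derivForm]
    refine (norm_pow_mul_derivForm_sub_le k (l + 1) u z x).trans ?_
    have := hseg z hz
    gcongr

theorem continuous_of_seminorm_sub {W : Type*} [TopologicalSpace W] {Φ : W → 𝓢(E, ℂ)}
    (h : ∀ w₀ k l, Filter.Tendsto (fun w => SchwartzMap.seminorm ℝ k l (Φ w - Φ w₀)) (nhds w₀)
      (nhds 0)) : Continuous Φ := by
  rw [continuous_iff_continuousAt]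
  intro w₀
  rw [ContinuousAt, (schwartz_withSeminorms ℝ E ℂ).tendsto_nhds]
  rintro ⟨k, l⟩ ε hε
  exact (h w₀ k l).eventually_lt_const hε

theorem _root_.Continuous.seminorm_sub {W : Type*} [TopologicalSpace W] {Φ : W → 𝓢(E, ℂ)}
    (h : Continuous Φ) (k l : ℕ) (w₀ : W) :
    Filter.Tendsto (fun w => SchwartzMap.seminorm ℝ k l (Φ w - Φ w₀)) (nhds w₀) (nhds 0) := by
  have hc : Continuous fun w => SchwartzMap.seminorm ℝ k l (Φ w - Φ w₀) :=
    ((schwartz_withSeminorms ℝ E ℂ).continuous_seminorm (k, l)).comp (h.sub continuous_const)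
  simpa using hc.tendsto w₀

theorem continuous_compSubConst {W : Type*} [TopologicalSpace W] {u : W → 𝓢(E, ℂ)} {a : W → E}
    (hu : Continuous u) (ha : Continuous a) :
    Continuous fun w => compSubConstCLM ℝ (a w) (u w) := by
  refine continuous_of_seminorm_sub fun w₀ k l => ?_
  refine squeeze_zero (g := fun w => 2 ^ k * (1 + ‖a w‖) ^ k *
      (SchwartzMap.seminorm ℝ k l (u w - u w₀) + SchwartzMap.seminorm ℝ 0 l (u w - u w₀)) +
      2 ^ k * (1 + (‖a w‖ + ‖a w₀‖)) ^ k * (SchwartzMap.seminorm ℝ k (l + 1) (u w₀) +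
        SchwartzMap.seminorm ℝ 0 (l + 1) (u w₀)) * ‖a w - a w₀‖)
    (fun w => apply_nonneg _ _) (fun w => ?_) ?_
  · have h : compSubConstCLM ℝ (a w) (u w) - compSubConstCLM ℝ (a w₀) (u w₀) =
        compSubConstCLM ℝ (a w) (u w - u w₀) +
          (compSubConstCLM ℝ (a w) (u w₀) - compSubConstCLM ℝ (a w₀) (u w₀)) := by
      rw [map_sub]; abel
    rw [h]
    refine (map_add_le_add _ _ _).trans (add_le_add ?_ ?_)
    · exact seminorm_compSubConst_le k l _ _
    · exact seminorm_compSubConst_sub_le k l _ _ _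
  · have h1 : Filter.Tendsto (fun w => ‖a w‖) (nhds w₀) (nhds ‖a w₀‖) := ha.norm.tendsto w₀
    have h2 : Filter.Tendsto (fun w => ‖a w - a w₀‖) (nhds w₀) (nhds 0) := by
      simpa using (ha.sub (continuous_const (y := a w₀))).norm.tendsto w₀
    have h3 := hu.seminorm_sub k l w₀
    have h4 := hu.seminorm_sub 0 l w₀
    have := ((((h1.const_add 1).pow k).const_mul (2 ^ k)).mul (h3.add h4)).add
      (((((h1.add_const ‖a w₀‖).const_add 1).pow k).const_mul (2 ^ k)).mul_const
        (SchwartzMap.seminorm ℝ k (l + 1) (u w₀) +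
        SchwartzMap.seminorm ℝ 0 (l + 1) (u w₀)) |>.mul h2)
    simpa using this

/-- A family of Schwartz functions whose seminorms grow at most polynomially in the parameter. -/
def PolynomiallyBounded {W : Type*} [Norm W] (Φ : W → 𝓢(E, ℂ)) : Prop :=
  ∀ k l, ∃ (C : ℝ) (N : ℕ), ∀ w, SchwartzMap.seminorm ℝ k l (Φ w) ≤ C * (1 + ‖w‖) ^ N

theorem PolynomiallyBounded.const {W : Type*} [SeminormedAddCommGroup W] (u : 𝓢(E, ℂ)) :
    PolynomiallyBounded fun _ : W => u := fun k l =>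
  ⟨SchwartzMap.seminorm ℝ k l u, 0, fun w => by simp⟩

theorem PolynomiallyBounded.compSubConst {W : Type*} [SeminormedAddCommGroup W]
    {u : W → 𝓢(E, ℂ)} (hu : PolynomiallyBounded u) {a : W → E} (ha : ∀ w, ‖a w‖ ≤ ‖w‖) :
    PolynomiallyBounded fun w => compSubConstCLM ℝ (a w) (u w) := fun k l => by
  obtain ⟨C, N, h⟩ := hu k l
  obtain ⟨C', N', h'⟩ := hu 0 l
  have hC : 0 ≤ C := by simpa using (apply_nonneg _ _).trans (h 0)
  have hC' : 0 ≤ C' := by simpa using (apply_nonneg _ _).trans (h' 0)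
  refine ⟨2 ^ k * (C + C'), k + (N + N'), fun w => ?_⟩
  have h1 : (1 : ℝ) ≤ 1 + ‖w‖ := by linarith [norm_nonneg w]
  calc _ ≤ 2 ^ k * (1 + ‖a w‖) ^ k *
      (SchwartzMap.seminorm ℝ k l (u w) + SchwartzMap.seminorm ℝ 0 l (u w)) :=
        seminorm_compSubConst_le k l _ _
    _ ≤ 2 ^ k * (1 + ‖w‖) ^ k * (C * (1 + ‖w‖) ^ (N + N') + C' * (1 + ‖w‖) ^ (N + N')) := by
        gcongr
        · exact ha w
        · exact (h w).trans (by gcongr; omega)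
        · exact (h' w).trans (by gcongr; omega)
    _ = _ := by rw [pow_add]; ring

/-- A seminorm of `T u` is dominated by finitely many seminorms of `u`; summing their constants and
exponents gives one polynomial bound. -/
theorem PolynomiallyBounded.clm_comp {W : Type*} [SeminormedAddCommGroup W]
    {u : W → 𝓢(E, ℂ)} (hu : PolynomiallyBounded u) (T : 𝓢(E, ℂ) →L[ℝ] 𝓢(E, ℂ)) :
    PolynomiallyBounded fun w => T (u w) := fun k l => by
  have hc : Continuous ((SchwartzMap.seminorm ℝ k l).comp T.toLinearMap) :=
    (((schwartz_withSeminorms ℝ E ℂ).continuous_seminorm (k, l)).comp T.continuous :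
      Continuous fun u => SchwartzMap.seminorm ℝ k l (T u))
  obtain ⟨s, C, -, hC⟩ := Seminorm.bound_of_continuous (schwartz_withSeminorms ℝ E ℂ) _ hc
  choose D M hDM using hu
  have hD (k l) : 0 ≤ D k l := by simpa using (apply_nonneg _ _).trans (hDM k l 0)
  refine ⟨C * ∑ i ∈ s, D i.1 i.2, ∑ i ∈ s, M i.1 i.2, fun w => ?_⟩
  have h1 : (1 : ℝ) ≤ 1 + ‖w‖ := by linarith [norm_nonneg w]
  refine (hC (u w)).trans ?_
  rw [smul_apply, NNReal.smul_def, smul_eq_mul, mul_assoc]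
  refine mul_le_mul_of_nonneg_left ?_ C.2
  refine Seminorm.finset_sup_apply_le
    (mul_nonneg (Finset.sum_nonneg fun i _ => hD _ _) (by positivity)) fun i hi => ?_
  refine (hDM i.1 i.2 w).trans ?_
  have h2 := Finset.single_le_sum (f := fun i : ℕ × ℕ => D i.1 i.2) (fun i _ => hD _ _) hi
  have h3 := Finset.single_le_sum (f := fun i : ℕ × ℕ => M i.1 i.2) (fun i _ => Nat.zero_le _) hi
  have h4 := hD i.1 i.2
  gcongr
  exact Finset.sum_nonneg fun i _ => hD _ _

end SchwartzMap

/-! ### Time-frequency shifts of a window -/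

namespace ModulationSpace

open FourierTransform

variable {n : ℕ}

/-- The Schwartz function `t ↦ e^{-i t·η} v(t - y)`. -/
def modTranslate (v : 𝓢(Rn n, ℂ)) (y η : Rn n) : 𝓢(Rn n, ℂ) :=
  SchwartzMap.smulLeftCLM ℂ (fun t : Rn n => Complex.exp (-Complex.I * ((inner ℝ t η : ℝ) : ℂ)))
    (SchwartzMap.compSubConstCLM ℝ y v)

theorem modTranslate_apply (v : 𝓢(Rn n, ℂ)) (y η t : Rn n) :
    modTranslate v y η t = Complex.exp (-Complex.I * ((inner ℝ t η : ℝ) : ℂ)) * v (t - y) := by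
  rw [modTranslate, SchwartzMap.smulLeftCLM_apply_apply (hasTemperateGrowth_wave η)]
  simp

/-- The complex conjugate of a Schwartz function. -/
def conjWindow (φ : 𝓢(Rn n, ℂ)) : 𝓢(Rn n, ℂ) :=
  SchwartzMap.postcompCLM (𝕜 := ℝ) (Complex.conjCLE : ℂ →L[ℝ] ℂ) φ

theorem conjWindow_apply (φ : 𝓢(Rn n, ℂ)) (t : Rn n) :
    conjWindow φ t = (starRingEnd ℂ) (φ t) := by simp [conjWindow]

theorem shiftedWindow_eq_modTranslate (φ : 𝓢(Rn n, ℂ)) (y η : Rn n) :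
    shiftedWindow φ y η = modTranslate (conjWindow φ) y η := by
  ext t
  rw [shiftedWindow_apply, modTranslate_apply, conjWindow_apply]

/-- Modulation is translation on the Fourier side. Continuity and growth in `η` thus reduce to the
results on translations and the continuity of the Fourier transform. -/
theorem modTranslate_eq_fourier (v : 𝓢(Rn n, ℂ)) (y η : Rn n) :
    modTranslate v y η = 𝓕⁻ (SchwartzMap.compSubConstCLM ℝ (-(2 * Real.pi)⁻¹ • η)
      (𝓕 (SchwartzMap.compSubConstCLM ℝ y v))) := by
  ext t
  rw [SchwartzMap.fourierInv_coe, Real.fourierInv_eq']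
  have h1 := integral_sub_right_eq_self (μ := (volume : Measure (Rn n)))
    (fun w => Complex.exp (((2 * Real.pi * inner ℝ (w + -(2 * Real.pi)⁻¹ • η) t : ℝ) : ℂ) *
      Complex.I) • (𝓕 (SchwartzMap.compSubConstCLM ℝ y v)) w) (-(2 * Real.pi)⁻¹ • η)
  simp only [sub_add_cancel] at h1
  simp only [SchwartzMap.compSubConstCLM_apply]
  rw [h1]
  have h2 : ∀ w : Rn n, Complex.exp (((2 * Real.pi * inner ℝ (w + -(2 * Real.pi)⁻¹ • η) t : ℝ) : ℂ)
      * Complex.I) = Complex.exp (-Complex.I * ((inner ℝ t η : ℝ) : ℂ)) *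
        Complex.exp (((2 * Real.pi * inner ℝ w t : ℝ) : ℂ) * Complex.I) := by
    intro w
    rw [← Complex.exp_add, inner_add_left, inner_smul_left, real_inner_comm η t]
    congr 1
    have := Real.pi_ne_zero
    simp only [map_neg, map_inv₀, conj_trivial]
    push_cast
    field_simp
    ring
  simp only [h2, smul_eq_mul]
  simp only [mul_assoc (Complex.exp (-Complex.I * _))]
  rw [integral_const_mul, modTranslate_apply]
  congr 1
  have h3 := congrArg (fun g : 𝓢(Rn n, ℂ) => g t)
    (fourierInv_fourier_eq (F := 𝓢(Rn n, ℂ)) (SchwartzMap.compSubConstCLM ℝ y v))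
  simp only [SchwartzMap.compSubConstCLM_apply] at h3
  rw [← h3, SchwartzMap.fourierInv_coe, Real.fourierInv_eq']
  rfl

theorem continuous_modTranslate (v : 𝓢(Rn n, ℂ)) :
    Continuous fun w : Rn n × Rn n => modTranslate v w.1 w.2 := by
  simp only [modTranslate_eq_fourier]
  refine (fourierInvCLM ℂ 𝓢(Rn n, ℂ)).continuous.comp
    (SchwartzMap.continuous_compSubConst ((fourierCLM ℂ 𝓢(Rn n, ℂ)).continuous.comp
      (SchwartzMap.continuous_compSubConst continuous_const continuous_fst)) ?_)
  fun_prop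

theorem polynomiallyBounded_modTranslate (v : 𝓢(Rn n, ℂ)) :
    SchwartzMap.PolynomiallyBounded fun w : Rn n × Rn n => modTranslate v w.1 w.2 := by
  simp only [modTranslate_eq_fourier]
  refine SchwartzMap.PolynomiallyBounded.clm_comp
    (T := (fourierInvCLM ℂ 𝓢(Rn n, ℂ)).restrictScalars ℝ) ?_
  refine SchwartzMap.PolynomiallyBounded.compSubConst ?_ fun w => ?_
  · refine SchwartzMap.PolynomiallyBounded.clm_comp
      (T := (fourierCLM ℂ 𝓢(Rn n, ℂ)).restrictScalars ℝ) ?_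
    exact (SchwartzMap.PolynomiallyBounded.const v).compSubConst fun w => norm_fst_le w
  · rw [norm_smul, norm_neg, norm_inv, Real.norm_of_nonneg (by positivity)]
    refine (mul_le_of_le_one_left (norm_nonneg _) ?_).trans (norm_snd_le w)
    exact inv_le_one_of_one_le₀ (by linarith [Real.two_le_pi])

end ModulationSpace

/-! ### Rapid decay of the STFT of Schwartz functions -/

namespace ModulationSpace

open FourierTransform

variable {n : ℕ}

/-- The weight `(1 + ‖x‖)^{-M}`. -/
def decayWeight (M : ℕ) (x : Rn n) : ℝ := ((1 + ‖x‖) ^ M)⁻¹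

theorem decayWeight_pos (M : ℕ) (x : Rn n) : 0 < decayWeight M x := by
  have := norm_nonneg x
  unfold decayWeight; positivity

theorem decayWeight_le_one (M : ℕ) (x : Rn n) : decayWeight M x ≤ 1 :=
  inv_le_one_of_one_le₀ (one_le_pow₀ (by linarith [norm_nonneg x]))

theorem continuous_decayWeight (M : ℕ) : Continuous (decayWeight (n := n) M) := by
  unfold decayWeight
  refine Continuous.inv₀ (by fun_prop) fun x => ?_
  have := norm_nonneg x
  positivity

theorem decayWeight_neg (M : ℕ) (x : Rn n) : decayWeight M (-x) = decayWeight M x := by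
  simp [decayWeight]

theorem integrable_decayWeight {M : ℕ} (hM : n < M) : Integrable (decayWeight (n := n) M) := by
  have h := integrable_one_add_norm (E := Rn n) (μ := volume) (r := (M : ℝ))
    (by rw [finrank_euclideanSpace_fin]; exact_mod_cast hM)
  refine h.congr (.of_forall fun x => ?_)
  have := norm_nonneg x
  simp only [decayWeight]
  rw [Real.rpow_neg (by positivity), Real.rpow_natCast]

theorem norm_mul_le_decayWeight (u : 𝓢(Rn n, ℂ)) (M : ℕ) :
    ∃ C : ℝ, 0 ≤ C ∧ ∀ x, ‖u x‖ ≤ C * decayWeight M x := by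
  refine ⟨2 ^ M * (Finset.Iic (M, 0)).sup (fun m => SchwartzMap.seminorm ℝ m.1 m.2) u,
    by positivity, fun x => ?_⟩
  have h := SchwartzMap.one_add_le_sup_seminorm_apply (𝕜 := ℝ) (m := (M, 0)) (k := M) (n := 0)
    le_rfl le_rfl u x
  rw [norm_iteratedFDeriv_zero] at h
  have := norm_nonneg x
  rw [decayWeight, ← div_eq_mul_inv, le_div_iff₀ (by positivity), mul_comm]
  exact h

theorem decayWeight_mul_sub_le (M : ℕ) (t y : Rn n) :
    decayWeight M t * decayWeight M (t - y) ≤ decayWeight M y := by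
  rw [decayWeight, decayWeight, decayWeight, ← mul_inv, ← mul_pow]
  have h0 := norm_nonneg y
  have h1 := norm_nonneg t
  have h2 := norm_nonneg (t - y)
  have h3 : ‖y‖ ≤ ‖t‖ + ‖t - y‖ := by
    simpa using norm_sub_le t (t - y)
  gcongr
  nlinarith

/-- Submultiplicativity of `1 + ‖·‖`: of the decay of `u`, order `M` is traded together with the
decay of `v` for decay in `y`, and the remaining order `n + 1` makes the integral converge. -/
theorem integral_norm_mul_norm_sub_le (u v : 𝓢(Rn n, ℂ)) (M : ℕ) :
    ∃ C : ℝ, 0 ≤ C ∧ ∀ y, ∫ t, ‖u t‖ * ‖v (t - y)‖ ≤ C * decayWeight M y := by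
  obtain ⟨C, hC, hu⟩ := norm_mul_le_decayWeight u (M + (n + 1))
  obtain ⟨D, hD, hv⟩ := norm_mul_le_decayWeight v M
  have hint := integrable_decayWeight (n := n) (Nat.lt_succ_self n)
  refine ⟨C * D * ∫ t : Rn n, decayWeight (n + 1) t, ?_, fun y => ?_⟩
  · have := integral_nonneg (μ := volume) (f := fun t : Rn n => decayWeight (n + 1) t)
      fun t => (decayWeight_pos (n + 1) t).le
    positivity
  · have h : ∀ t, ‖u t‖ * ‖v (t - y)‖ ≤ (C * D * decayWeight M y) * decayWeight (n + 1) t := by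
      intro t
      have e : decayWeight (M + (n + 1)) t = decayWeight M t * decayWeight (n + 1) t := by
        simp only [decayWeight, pow_add, mul_inv]
      calc ‖u t‖ * ‖v (t - y)‖ ≤ (C * decayWeight (M + (n + 1)) t) * (D * decayWeight M (t - y)) :=
            mul_le_mul (hu t) (hv _) (norm_nonneg _) (mul_nonneg hC (decayWeight_pos _ _).le)
        _ = C * D * (decayWeight M t * decayWeight M (t - y)) * decayWeight (n + 1) t := by
            rw [e]; ring
        _ ≤ _ := by
            have := (decayWeight_pos (n + 1) t).le
            have := decayWeight_mul_sub_le M t y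
            gcongr
    calc _ ≤ ∫ t : Rn n, (C * D * decayWeight M y) * decayWeight (n + 1) t :=
          integral_mono_of_nonneg (.of_forall fun t => by positivity) (hint.const_mul _)
            (.of_forall h)
      _ = _ := by rw [integral_const_mul]; ring

/-- The short-time Fourier transform of the Schwartz function `u` with the (unconjugated,
Schwartz) window `v`, without normalisation. -/
def crossSTFT (u v : 𝓢(Rn n, ℂ)) (y η : Rn n) : ℂ := ∫ t, u t * modTranslate v y η t

theorem norm_modTranslate (v : 𝓢(Rn n, ℂ)) (y η t : Rn n) :
    ‖modTranslate v y η t‖ = ‖v (t - y)‖ := by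
  rw [modTranslate_apply, norm_mul, Complex.norm_exp]
  simp

theorem norm_crossSTFT_le (u v : 𝓢(Rn n, ℂ)) (y η : Rn n) :
    ‖crossSTFT u v y η‖ ≤ ∫ t, ‖u t‖ * ‖v (t - y)‖ := by
  refine (norm_integral_le_integral_norm _).trans_eq ?_
  simp only [norm_mul, norm_modTranslate]

theorem norm_fourierInv_modTranslate (v : 𝓢(Rn n, ℂ)) (y η ω : Rn n) :
    ‖(𝓕⁻ (modTranslate v y η)) ω‖ = ‖(𝓕⁻ v) (ω - (2 * Real.pi)⁻¹ • η)‖ := by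
  rw [SchwartzMap.fourierInv_coe, SchwartzMap.fourierInv_coe, Real.fourierInv_eq',
    Real.fourierInv_eq']
  have h1 := integral_sub_right_eq_self (μ := (volume : Measure (Rn n)))
    (fun t => Complex.exp (((2 * Real.pi * inner ℝ (t + y) ω : ℝ) : ℂ) * Complex.I) •
      (Complex.exp (-Complex.I * ((inner ℝ (t + y) η : ℝ) : ℂ)) * v t)) y
  simp only [sub_add_cancel] at h1
  simp only [modTranslate_apply]
  rw [h1]
  have h2 : ∀ t : Rn n, Complex.exp (((2 * Real.pi * inner ℝ (t + y) ω : ℝ) : ℂ) * Complex.I) •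
      (Complex.exp (-Complex.I * ((inner ℝ (t + y) η : ℝ) : ℂ)) * v t) =
      Complex.exp (((2 * Real.pi * inner ℝ y ω - inner ℝ y η : ℝ) : ℂ) * Complex.I) *
      (Complex.exp (((2 * Real.pi * inner ℝ t (ω - (2 * Real.pi)⁻¹ • η) : ℝ) : ℂ) * Complex.I) •
        v t) := by
    intro t
    rw [smul_eq_mul, smul_eq_mul, ← mul_assoc, ← mul_assoc, ← Complex.exp_add, ← Complex.exp_add,
      inner_add_left, inner_add_left, inner_sub_right, inner_smul_right]
    congr 2
    have := Real.pi_ne_zero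
    push_cast
    field_simp
    ring
  simp only [h2]
  rw [integral_const_mul, norm_mul, Complex.norm_exp_ofReal_mul_I, one_mul]

theorem crossSTFT_eq_fourier (u v : 𝓢(Rn n, ℂ)) (y η : Rn n) :
    crossSTFT u v y η = ∫ ω, (𝓕 u) ω * (𝓕⁻ (modTranslate v y η)) ω := by
  rw [← SchwartzMap.integral_fourierInv_mul_eq, fourierInv_fourier_eq]
  rfl

/-- On the Fourier side `η` acts as a translation, so the convolution estimate that yields decay in
`y` also yields decay in `η`. -/
theorem norm_crossSTFT_le_fourier (u v : 𝓢(Rn n, ℂ)) (y η : Rn n) :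
    ‖crossSTFT u v y η‖ ≤
      ∫ ω, ‖(𝓕 u) ω‖ * ‖(𝓕⁻ v) (ω - (2 * Real.pi)⁻¹ • η)‖ := by
  rw [crossSTFT_eq_fourier]
  refine (norm_integral_le_integral_norm _).trans_eq ?_
  simp only [norm_mul, norm_fourierInv_modTranslate]

/-- The short-time Fourier transform of a Schwartz function with a Schwartz window decays faster
than any polynomial. -/
theorem norm_crossSTFT_le_decayWeight (u v : 𝓢(Rn n, ℂ)) (M : ℕ) :
    ∃ C : ℝ, 0 ≤ C ∧ ∀ y η, ‖crossSTFT u v y η‖ ≤ C * (decayWeight M y * decayWeight M η) := by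
  obtain ⟨C, hC, h1⟩ := integral_norm_mul_norm_sub_le u v (2 * M)
  obtain ⟨D, hD, h2⟩ := integral_norm_mul_norm_sub_le (𝓕 u) (𝓕⁻ v) (2 * M)
  -- One bound decays in `y` only, the other in `η` only. Their geometric mean decays in both, which
  -- is why each is taken with order `2 * M`.
  refine ⟨√(C * (D * (2 * Real.pi) ^ (2 * M))), Real.sqrt_nonneg _, fun y η => ?_⟩
  have e : ∀ x : Rn n, decayWeight (2 * M) x = decayWeight M x ^ 2 := by
    intro x
    simp only [decayWeight, inv_pow, ← pow_mul, mul_comm]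
  have h3 : decayWeight (2 * M) ((2 * Real.pi)⁻¹ • η) ≤
      (2 * Real.pi) ^ (2 * M) * decayWeight (2 * M) η := by
    have hpi := Real.two_le_pi
    have h0 := norm_nonneg η
    rw [decayWeight, decayWeight, ← div_eq_mul_inv, le_div_iff₀ (by positivity), mul_comm,
      ← div_eq_mul_inv, div_le_iff₀ (by positivity), ← mul_pow]
    refine pow_le_pow_left₀ (by positivity) ?_ _
    rw [norm_smul, norm_inv, Real.norm_of_nonneg (by positivity), mul_add,
      mul_inv_cancel_left₀ (by positivity)]
    linarith
  have ha := (norm_crossSTFT_le u v y η).trans (h1 y)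
  have hb := (norm_crossSTFT_le_fourier u v y η).trans ((h2 _).trans
    (mul_le_mul_of_nonneg_left h3 hD))
  have hy := decayWeight_pos M y
  have hη := decayWeight_pos M η
  rw [e] at ha hb
  refine abs_le_of_sq_le_sq' ?_ (by positivity) |>.2
  rw [mul_pow, Real.sq_sqrt (by positivity)]
  calc ‖crossSTFT u v y η‖ ^ 2 = ‖crossSTFT u v y η‖ * ‖crossSTFT u v y η‖ := sq _
    _ ≤ (C * decayWeight M y ^ 2) * (D * ((2 * Real.pi) ^ (2 * M) * decayWeight M η ^ 2)) :=
        mul_le_mul ha hb (norm_nonneg _) (by positivity)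
    _ = _ := by ring

end ModulationSpace

/-! ### Inversion formula for the STFT -/

namespace ModulationSpace

open FourierTransform

variable {n : ℕ}

theorem crossSTFT_neg_eq_fourier (u v : 𝓢(Rn n, ℂ)) (y η : Rn n) :
    crossSTFT u v y (-η) = (𝓕 (SchwartzMap.smulLeftCLM ℂ u (SchwartzMap.compSubConstCLM ℝ y v)))
      (-(2 * Real.pi)⁻¹ • η) := by
  rw [SchwartzMap.fourier_coe, Real.fourier_eq', crossSTFT]
  congr 1
  ext s
  rw [modTranslate_apply, SchwartzMap.smulLeftCLM_apply_apply u.hasTemperateGrowth, inner_neg_right,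
    inner_smul_right]
  simp only [smul_eq_mul, SchwartzMap.compSubConstCLM_apply]
  have e : -Complex.I * ((-inner ℝ s η : ℝ) : ℂ) =
      ((-2 * Real.pi * (-(2 * Real.pi)⁻¹ * inner ℝ s η) : ℝ) : ℂ) * Complex.I := by
    have := Real.pi_ne_zero
    push_cast
    field_simp
  rw [e]
  ring

/-- Fourier inversion in the frequency variable for the short-time Fourier transform. -/
theorem integral_crossSTFT_mul_exp (u v : 𝓢(Rn n, ℂ)) (y t : Rn n) :
    ∫ η, crossSTFT u v y (-η) * Complex.exp (-Complex.I * ((inner ℝ t η : ℝ) : ℂ)) =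
      ((2 * Real.pi) ^ n : ℝ) * (u t * v (t - y)) := by
  set h : 𝓢(Rn n, ℂ) := SchwartzMap.smulLeftCLM ℂ u (SchwartzMap.compSubConstCLM ℝ y v) with hh
  have h1 : h t = ∫ ω, Complex.exp (((2 * Real.pi * inner ℝ ω t : ℝ) : ℂ) * Complex.I) •
      (𝓕 h) ω := by
    rw [← Real.fourierInv_eq', ← SchwartzMap.fourierInv_coe, fourierInv_fourier_eq]
  have h2 : h t = u t * v (t - y) := by
    rw [hh, SchwartzMap.smulLeftCLM_apply_apply u.hasTemperateGrowth]
    simp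
  -- The substitution `ω = -η / (2π)` reconciles the two Fourier normalisations; its Jacobian is the
  -- source of `(2π)^n`.
  have h3 := Measure.integral_comp_smul (volume : Measure (Rn n))
    (fun ω => Complex.exp (((2 * Real.pi * inner ℝ ω t : ℝ) : ℂ) * Complex.I) • (𝓕 h) ω)
    (-(2 * Real.pi)⁻¹)
  rw [← h1, h2, finrank_euclideanSpace_fin] at h3
  have h4 : |((-(2 * Real.pi)⁻¹ : ℝ) ^ n)⁻¹| = (2 * Real.pi) ^ n := by
    rw [abs_inv, abs_pow, abs_neg, abs_of_pos (by positivity), inv_pow, inv_inv]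
  rw [h4, Complex.real_smul] at h3
  rw [← h3]
  congr 1
  ext η
  rw [crossSTFT_neg_eq_fourier, inner_smul_left, smul_eq_mul, mul_comm, real_inner_comm]
  congr 2
  have := Real.pi_ne_zero
  simp only [map_neg, map_inv₀, conj_trivial]
  push_cast
  field_simp

theorem continuous_crossSTFT (u v : 𝓢(Rn n, ℂ)) :
    Continuous fun w : Rn n × Rn n => crossSTFT u v w.1 w.2 := by
  have h : ∀ w : Rn n × Rn n, crossSTFT u v w.1 w.2 =
      SchwartzMap.integralCLM ℂ volume (SchwartzMap.smulLeftCLM ℂ u (modTranslate v w.1 w.2)) := by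
    intro w
    rw [SchwartzMap.integralCLM_apply, crossSTFT]
    simp only [SchwartzMap.smulLeftCLM_apply_apply u.hasTemperateGrowth, smul_eq_mul]
  simp only [h]
  exact (SchwartzMap.integralCLM ℂ volume).continuous.comp
    ((SchwartzMap.smulLeftCLM ℂ u).continuous.comp (continuous_modTranslate v))

theorem continuous_crossSTFT_neg (u v : 𝓢(Rn n, ℂ)) :
    Continuous fun w : Rn n × Rn n => crossSTFT u v w.1 (-w.2) := by
  have h : Continuous (Prod.map id Neg.neg : Rn n × Rn n → Rn n × Rn n) :=
    continuous_id.prodMap continuous_neg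
  have h2 := (continuous_crossSTFT u v).comp h
  simpa only [Function.comp_def, Prod.map_fst, Prod.map_snd, id] using h2

theorem integrable_decayWeight_mul {M : ℕ} (hM : n < M) :
    Integrable fun w : Rn n × Rn n => decayWeight M w.1 * decayWeight M w.2 :=
  (integrable_decayWeight hM).mul_prod (integrable_decayWeight hM)

/-- Decay of order `N` in each variable absorbs polynomial growth of degree `N` in the pair, since
`1 + ‖w‖ ≤ (1 + ‖w.1‖)(1 + ‖w.2‖)`; order `n + 1` is left over for integrability. -/
theorem decayWeight_mul_mul_pow_le (N : ℕ) (w : Rn n × Rn n) :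
    decayWeight (n + 1 + N) w.1 * decayWeight (n + 1 + N) w.2 * (1 + ‖w‖) ^ N ≤
      decayWeight (n + 1) w.1 * decayWeight (n + 1) w.2 := by
  have h1 := norm_nonneg w.1
  have h2 := norm_nonneg w.2
  have h3 : 1 + ‖w‖ ≤ (1 + ‖w.1‖) * (1 + ‖w.2‖) := by
    rw [Prod.norm_def]
    rcases max_cases ‖w.1‖ ‖w.2‖ with h | h <;> rw [h.1] <;> nlinarith
  have h4 : (1 + ‖w‖) ^ N ≤ (1 + ‖w.1‖) ^ N * (1 + ‖w.2‖) ^ N := by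
    rw [← mul_pow]
    exact pow_le_pow_left₀ (by positivity) h3 N
  have e : ∀ x : Rn n, decayWeight (n + 1 + N) x * (1 + ‖x‖) ^ N = decayWeight (n + 1) x := by
    intro x
    have := norm_nonneg x
    simp only [decayWeight, pow_add, mul_inv]
    field_simp
  calc _ ≤ decayWeight (n + 1 + N) w.1 * decayWeight (n + 1 + N) w.2 *
        ((1 + ‖w.1‖) ^ N * (1 + ‖w.2‖) ^ N) := by
        have := (decayWeight_pos (n + 1 + N) w.1).le
        have := (decayWeight_pos (n + 1 + N) w.2).le
        gcongr
    _ = _ := by rw [← e w.1, ← e w.2]; ring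

theorem integrable_crossSTFT_mul_of_le {u v : 𝓢(Rn n, ℂ)} {g : Rn n × Rn n → ℝ}
    (hg : Continuous g) {C : ℝ} {N : ℕ} (hgC : ∀ w, |g w| ≤ C * (1 + ‖w‖) ^ N) :
    Integrable fun w : Rn n × Rn n => ‖crossSTFT u v w.1 (-w.2)‖ * g w := by
  obtain ⟨D, hD, h⟩ := norm_crossSTFT_le_decayWeight u v (n + 1 + N)
  have hC : 0 ≤ C := by simpa using (abs_nonneg _).trans (hgC 0)
  refine ((integrable_decayWeight_mul (Nat.lt_succ_self n)).const_mul (D * C)).mono'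
    ((continuous_crossSTFT_neg u v).norm.mul hg).aestronglyMeasurable (.of_forall fun w => ?_)
  rw [norm_mul, norm_norm, Real.norm_eq_abs]
  have hw := h w.1 (-w.2)
  rw [decayWeight_neg] at hw
  calc _ ≤ (D * (decayWeight (n + 1 + N) w.1 * decayWeight (n + 1 + N) w.2)) *
        (C * (1 + ‖w‖) ^ N) := by
        exact mul_le_mul hw (hgC w) (abs_nonneg _) ((norm_nonneg _).trans hw)
    _ = D * C * (decayWeight (n + 1 + N) w.1 * decayWeight (n + 1 + N) w.2 * (1 + ‖w‖) ^ N) := by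
        ring
    _ ≤ _ := by
        have := decayWeight_mul_mul_pow_le N w
        gcongr

theorem integrable_crossSTFT_mul_modTranslate (u φ ψ : 𝓢(Rn n, ℂ)) (t : Rn n) :
    Integrable fun w : Rn n × Rn n => crossSTFT u φ w.1 (-w.2) * modTranslate ψ w.1 w.2 t := by
  have hc : Continuous fun w : Rn n × Rn n => modTranslate ψ w.1 w.2 t := by
    simp only [modTranslate_apply]
    exact (by fun_prop : Continuous fun w : Rn n × Rn n =>
      Complex.exp (-Complex.I * ((inner ℝ t w.2 : ℝ) : ℂ))).mul
        (ψ.continuous.comp (continuous_const.sub continuous_fst))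
  have h := integrable_crossSTFT_mul_of_le (u := u) (v := φ) (N := 0) hc.norm
    (C := SchwartzMap.seminorm ℝ 0 0 ψ) fun w => by
      rw [abs_norm, norm_modTranslate, pow_zero, mul_one]
      exact SchwartzMap.norm_le_seminorm ℝ ψ _
  refine h.mono' ((continuous_crossSTFT_neg u φ).mul hc).aestronglyMeasurable
    (.of_forall fun w => (norm_mul _ _).le)

/-- The constant in the inversion formula for the short-time Fourier transform. -/
def inversionConst (φ : 𝓢(Rn n, ℂ)) : ℝ := (2 * Real.pi) ^ n * ∫ t, ‖φ t‖ ^ 2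

theorem inversionConst_pos {φ : 𝓢(Rn n, ℂ)} (hφ : φ ≠ 0) : 0 < inversionConst φ := by
  refine mul_pos (by positivity) ?_
  obtain ⟨t, ht⟩ : ∃ t, φ t ≠ 0 := by
    by_contra! h
    exact hφ (SchwartzMap.ext h)
  have hc : Continuous fun t => ‖φ t‖ ^ 2 := φ.continuous.norm.pow 2
  refine integral_pos_of_integrable_nonneg_nonzero (x := t) hc ?_ (fun t => by positivity)
    (by simpa using ht)
  exact (φ.memLp 2).integrable_norm_pow two_ne_zero
  
/-- Inversion formula for the short-time Fourier transform of Schwartz functions. -/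
theorem integral_crossSTFT_mul_shiftedWindow (u φ : 𝓢(Rn n, ℂ)) (t : Rn n) :
    ∫ w : Rn n × Rn n, crossSTFT u φ w.1 (-w.2) * shiftedWindow φ w.1 w.2 t =
      (inversionConst φ : ℂ) * u t := by
  simp only [shiftedWindow_eq_modTranslate]
  rw [Measure.volume_eq_prod, integral_prod _
    (integrable_crossSTFT_mul_modTranslate u φ (conjWindow φ) t)]
  have h : ∀ y, ∫ η, crossSTFT u φ y (-η) * modTranslate (conjWindow φ) y η t =
      ((2 * Real.pi) ^ n : ℝ) * u t * ((‖φ (t - y)‖ ^ 2 : ℝ) : ℂ) := by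
    intro y
    have e : ∀ η, crossSTFT u φ y (-η) * modTranslate (conjWindow φ) y η t =
        (crossSTFT u φ y (-η) * Complex.exp (-Complex.I * ((inner ℝ t η : ℝ) : ℂ))) *
          (starRingEnd ℂ) (φ (t - y)) := by
      intro η
      rw [modTranslate_apply, conjWindow_apply]; ring
    simp only [e]
    rw [integral_mul_const, integral_crossSTFT_mul_exp, mul_assoc, mul_assoc, Complex.mul_conj']
    push_cast
    ring
  simp only [h]
  rw [integral_const_mul, integral_complex_ofReal,
    integral_sub_left_eq_self (fun y => ‖φ y‖ ^ 2) volume t, inversionConst]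
  push_cast
  ring

/-- Inversion formula for the short-time Fourier transform of tempered distributions. -/
theorem inversionConst_mul_apply (φ u : 𝓢(Rn n, ℂ)) (f : 𝓢'(Rn n, ℂ)) :
    (inversionConst φ : ℂ) * f u =
      ∫ w : Rn n × Rn n, crossSTFT u φ w.1 (-w.2) * f (shiftedWindow φ w.1 w.2) := by
  let f' : 𝓢(Rn n, ℂ) →L[ℂ] ℂ := ⟨f.toLinearMap, f.continuous⟩
  have hc : Continuous fun w : Rn n × Rn n => shiftedWindow φ w.1 w.2 := by
    simp only [shiftedWindow_eq_modTranslate]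
    exact continuous_modTranslate _
  have hΦ : Continuous fun w : Rn n × Rn n => crossSTFT u φ w.1 (-w.2) • shiftedWindow φ w.1 w.2 :=
    (continuous_crossSTFT_neg u φ).smul hc
  have key := SchwartzMap.map_eq_integral (μ := volume) (g := (inversionConst φ : ℂ) • u) hΦ
    (fun k l => ?_) (fun t => ?_) f'
  · rw [map_smul] at key
    refine key.trans ?_
    congr 1
    ext w
    exact map_smul f' _ _
  · have e : ∀ w : Rn n × Rn n,
        SchwartzMap.seminorm ℝ k l (crossSTFT u φ w.1 (-w.2) • shiftedWindow φ w.1 w.2) =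
        ‖crossSTFT u φ w.1 (-w.2)‖ * SchwartzMap.seminorm ℝ k l (shiftedWindow φ w.1 w.2) :=
      fun w => map_smul_eq_mul (SchwartzMap.seminorm ℂ k l) _ _
    simp only [e]
    obtain ⟨C, N, hCN⟩ := polynomiallyBounded_modTranslate (conjWindow φ) k l
    refine integrable_crossSTFT_mul_of_le (C := C) (N := N)
      (((schwartz_withSeminorms ℝ (Rn n) ℂ).continuous_seminorm (k, l)).comp hc) fun w => ?_
    rw [abs_of_nonneg (apply_nonneg _ _), shiftedWindow_eq_modTranslate]
    exact hCN w
  · exact (integral_crossSTFT_mul_shiftedWindow u φ t).symm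

end ModulationSpace

/-! ### Sufficiency: from `M^s_{p,q}` to `M^0_{∞,1}` -/

namespace ModulationSpace

open FourierTransform

variable {n : ℕ}

theorem continuous_shiftedWindow (φ : 𝓢(Rn n, ℂ)) :
    Continuous fun w : Rn n × Rn n => shiftedWindow φ w.1 w.2 := by
  simp only [shiftedWindow_eq_modTranslate]
  exact continuous_modTranslate _

theorem continuous_stft (φ : 𝓢(Rn n, ℂ)) (f : 𝓢'(Rn n, ℂ)) :
    Continuous fun w : Rn n × Rn n => stft φ f w.1 w.2 :=
  continuous_const.mul (f.continuous.comp (continuous_shiftedWindow φ))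

theorem continuous_stft_left (φ : 𝓢(Rn n, ℂ)) (f : 𝓢'(Rn n, ℂ)) (ξ : Rn n) :
    Continuous fun x : Rn n => stft φ f x ξ := by
  have h := (continuous_stft φ f).comp (Continuous.prodMk_left ξ)
  simpa only [Function.comp_def] using h

theorem continuous_stft_right (φ : 𝓢(Rn n, ℂ)) (f : 𝓢'(Rn n, ℂ)) (x : Rn n) :
    Continuous fun ξ : Rn n => stft φ f x ξ := by
  have h := (continuous_stft φ f).comp (Continuous.prodMk_right x)
  simpa only [Function.comp_def] using h

/-- The inversion formula for tempered distributions in terms of the short-time Fourier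
transform. -/
theorem inversionConst_mul_apply_stft (φ u : 𝓢(Rn n, ℂ)) (f : 𝓢'(Rn n, ℂ)) :
    (((2 * Real.pi) ^ (-(n : ℝ) / 2) : ℝ) : ℂ) * ((inversionConst φ : ℂ) * f u) =
      ∫ w : Rn n × Rn n, crossSTFT u φ w.1 (-w.2) * stft φ f w.1 w.2 := by
  rw [inversionConst_mul_apply, ← integral_const_mul]
  congr 1
  ext w
  rw [stft]; ring

/-- Covariance: up to a unimodular factor, the reproducing kernel depends only on differences of
time-frequency points. -/
theorem norm_crossSTFT_shiftedWindow (φ : 𝓢(Rn n, ℂ)) (x ξ y η : Rn n) :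
    ‖crossSTFT (shiftedWindow φ x ξ) φ y (-η)‖ =
      ‖crossSTFT (conjWindow φ) φ (y - x) (ξ - η)‖ := by
  rw [crossSTFT, ← integral_add_right_eq_self _ x, crossSTFT]
  have e : ∀ t, shiftedWindow φ x ξ (t + x) * modTranslate φ y (-η) (t + x) =
      Complex.exp (((-inner ℝ x (ξ - η) : ℝ) : ℂ) * Complex.I) *
        (conjWindow φ t * modTranslate φ (y - x) (ξ - η) t) := by
    intro t
    rw [shiftedWindow_apply, modTranslate_apply, modTranslate_apply, conjWindow_apply,
      add_sub_cancel_right, show t + x - y = t - (y - x) by abel]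
    have h : Complex.exp (-Complex.I * ((inner ℝ (t + x) ξ : ℝ) : ℂ)) *
        Complex.exp (-Complex.I * ((inner ℝ (t + x) (-η) : ℝ) : ℂ)) =
        Complex.exp (((-inner ℝ x (ξ - η) : ℝ) : ℂ) * Complex.I) *
        Complex.exp (-Complex.I * ((inner ℝ t (ξ - η) : ℝ) : ℂ)) := by
      rw [← Complex.exp_add, ← Complex.exp_add, inner_add_left, inner_add_left, inner_neg_right,
        inner_neg_right, inner_sub_right, inner_sub_right]
      congr 1
      push_cast
      ring
    linear_combination (starRingEnd ℂ) (φ t) * φ (t - (y - x)) * h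
  simp only [e]
  rw [integral_const_mul, norm_mul, Complex.norm_exp_ofReal_mul_I, one_mul]

theorem enorm_decayWeight (M : ℕ) (x : Rn n) :
    ‖decayWeight M x‖ₑ = ENNReal.ofReal (decayWeight M x) :=
  Real.enorm_of_nonneg (decayWeight_pos M x).le

theorem lintegral_decayWeight_lt_top {M : ℕ} (hM : n < M) :
    ∫⁻ x : Rn n, ‖decayWeight M x‖ₑ < ∞ :=
  (integrable_decayWeight hM).hasFiniteIntegral

theorem eLpNorm_decayWeight_lt_top {M : ℕ} (hM : n < M) {p : ℝ≥0∞} (hp : 1 ≤ p) :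
    eLpNorm (decayWeight (n := n) M) p volume < ∞ := by
  rcases eq_or_ne p ∞ with rfl | hp'
  · rw [eLpNorm_exponent_top]
    refine (eLpNormEssSup_le_of_ae_bound (C := 1) (.of_forall fun x => ?_)).trans_lt
      ENNReal.ofReal_lt_top
    rw [Real.norm_of_nonneg (decayWeight_pos M x).le]
    exact decayWeight_le_one M x
  · rw [eLpNorm_lt_top_iff_lintegral_rpow_enorm_lt_top (by positivity) hp']
    refine (lintegral_mono fun x => ?_).trans_lt (lintegral_decayWeight_lt_top hM)
    refine ENNReal.rpow_le_self_of_le_one ?_ ?_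
    · rw [enorm_decayWeight]
      exact ENNReal.ofReal_le_one.2 (decayWeight_le_one M x)
    · rw [← ENNReal.toReal_one]
      exact ENNReal.toReal_mono hp' hp

/-- Hölder's inequality for nonnegative extended functions, for all exponents. -/
theorem lintegral_mul_le_eLpNorm_mul_eLpNorm {α : Type*} [MeasurableSpace α] {μ : Measure α}
    {p q : ℝ≥0∞} [hpq : p.HolderConjugate q] {G H : α → ℝ≥0∞} (hG : AEMeasurable G μ)
    (hH : AEMeasurable H μ) :
    ∫⁻ x, G x * H x ∂μ ≤ eLpNorm G p μ * eLpNorm H q μ := by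
  have key : ∀ {G H : α → ℝ≥0∞}, AEMeasurable H μ →
      ∫⁻ x, G x * H x ∂μ ≤ eLpNorm G ∞ μ * eLpNorm H 1 μ := by
    intro G H hH
    rw [eLpNorm_exponent_top, eLpNorm_one_eq_lintegral_enorm, ← lintegral_const_mul'' _ hH.enorm]
    refine lintegral_mono_ae ?_
    filter_upwards [ae_le_eLpNormEssSup (f := G) (μ := μ)] with x hx
    exact mul_le_mul_left hx _
  rcases eq_or_ne p ∞ with rfl | hp
  · obtain rfl : q = 1 := ENNReal.HolderConjugate.unique ∞ q 1
    exact key hH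
  rcases eq_or_ne q ∞ with rfl | hq
  · obtain rfl : p = 1 := ENNReal.HolderConjugate.unique ∞ p 1
    simp only [mul_comm (G _)]
    rw [mul_comm]
    exact key hG
  have h1 : 1 < p.toReal := by
    rw [← ENNReal.toReal_one, ENNReal.toReal_lt_toReal ENNReal.one_ne_top hp,
      ← ENNReal.HolderConjugate.lt_top_iff_one_lt q p]
    exact hq.lt_top
  have h := ENNReal.HolderConjugate.toReal (q := q) h1
  rw [eLpNorm_eq_lintegral_rpow_enorm_toReal (ENNReal.HolderConjugate.ne_zero p q) hp,
    eLpNorm_eq_lintegral_rpow_enorm_toReal (ENNReal.HolderConjugate.ne_zero q p) hq]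
  exact ENNReal.lintegral_mul_le_Lp_mul_Lq μ h hG hH

/-- The `L^p` norm of `V_φ f(·, ξ)`. -/
def stftNorm (φ : 𝓢(Rn n, ℂ)) (p : ℝ≥0∞) (f : 𝓢'(Rn n, ℂ)) (ξ : Rn n) : ℝ≥0∞ :=
  eLpNorm (fun x => stft φ f x ξ) p volume

/-- By Fatou's lemma for `L^p` norms and the continuity of the STFT in `ξ`, this function is lower
semicontinuous. That works for every `p`, including `∞`. -/
theorem measurable_stftNorm (φ : 𝓢(Rn n, ℂ)) (p : ℝ≥0∞) (f : 𝓢'(Rn n, ℂ)) :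
    Measurable (stftNorm φ p f) := by
  refine LowerSemicontinuous.measurable ?_
  rw [lowerSemicontinuous_iff_isClosed_preimage]
  intro c
  refine IsSeqClosed.isClosed fun ξ ξ₀ hξ hlim => ?_
  have h := Lp.eLpNorm_lim_le_liminf_eLpNorm (μ := (volume : Measure (Rn n))) (p := p)
    (f := fun k x => stft φ f x (ξ k))
    (fun k => (continuous_stft_left φ f _).aestronglyMeasurable)
    (fun x => stft φ f x ξ₀)
    (.of_forall fun x => ((continuous_stft_right φ f x).tendsto ξ₀).comp hlim)
  refine h.trans ?_
  exact Filter.liminf_le_of_frequently_le' (.of_forall hξ)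

/-- Apply the inversion formula to the shifted window itself, bound the kernel by its decay, and use
Hölder in `y` with exponents `p'` and `p`. The translated weight has the same `L^{p'}` norm for all
`x`, so the bound is uniform in `x`. -/
theorem exists_enorm_stft_le {φ : 𝓢(Rn n, ℂ)} (hφ : φ ≠ 0) {p : ℝ≥0∞} (hp : 1 ≤ p) :
    ∃ C : ℝ≥0∞, C ≠ ∞ ∧ ∀ (f : 𝓢'(Rn n, ℂ)) (x ξ : Rn n),
      ‖stft φ f x ξ‖ₑ ≤ C * ∫⁻ η, ‖decayWeight (n + 1) (ξ - η)‖ₑ * stftNorm φ p f η := by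
  obtain ⟨C, hC, hdec⟩ := norm_crossSTFT_le_decayWeight (conjWindow φ) φ (n + 1)
  have hK := inversionConst_pos hφ
  have : ENNReal.HolderConjugate p (1 - p⁻¹)⁻¹ := ENNReal.HolderConjugate.inv_one_sub_inv' hp
  have hp'1 : 1 ≤ (1 - p⁻¹)⁻¹ := ENNReal.HolderConjugate.one_le _ p
  set p' := (1 - p⁻¹)⁻¹
  set A := eLpNorm (decayWeight (n := n) (n + 1)) p' volume with hA
  have hAtop : A ≠ ∞ := (eLpNorm_decayWeight_lt_top (Nat.lt_succ_self n) hp'1).ne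
  refine ⟨ENNReal.ofReal ((inversionConst φ)⁻¹ * C) * A,
    ENNReal.mul_ne_top ENNReal.ofReal_ne_top hAtop, fun f x ξ => ?_⟩
  have hm : Measurable (decayWeight (n := n) (n + 1)) := (continuous_decayWeight _).measurable
  have h1 : stft φ f x ξ = ((inversionConst φ)⁻¹ : ℝ) *
      ∫ w : Rn n × Rn n, crossSTFT (shiftedWindow φ x ξ) φ w.1 (-w.2) * stft φ f w.1 w.2 := by
    rw [← inversionConst_mul_apply_stft, stft]
    have : (inversionConst φ : ℂ) ≠ 0 := by exact_mod_cast hK.ne'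
    push_cast
    field_simp
  have h2 : ∀ w : Rn n × Rn n,
      ‖crossSTFT (shiftedWindow φ x ξ) φ w.1 (-w.2) * stft φ f w.1 w.2‖ₑ ≤
      ENNReal.ofReal C * (‖decayWeight (n + 1) (ξ - w.2)‖ₑ *
        (‖decayWeight (n + 1) (w.1 - x)‖ₑ * ‖stft φ f w.1 w.2‖ₑ)) := by
    intro w
    rw [enorm_mul, ← mul_assoc, ← mul_assoc]
    gcongr
    rw [enorm_decayWeight, enorm_decayWeight, ← ENNReal.ofReal_mul hC,
      ← ENNReal.ofReal_mul (mul_nonneg hC (decayWeight_pos _ _).le), ← ofReal_norm,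
      norm_crossSTFT_shiftedWindow]
    refine ENNReal.ofReal_le_ofReal ((hdec _ _).trans_eq ?_)
    ring
  have h3 : ∀ η, ∫⁻ y, ‖decayWeight (n + 1) (y - x)‖ₑ * ‖stft φ f y η‖ₑ ≤ A * stftNorm φ p f η := by
    intro η
    refine (lintegral_mul_le_eLpNorm_mul_eLpNorm (p := p') (q := p)
      (hm.comp (measurable_id.sub_const x)).enorm.aemeasurable
      (continuous_stft_left φ f η).measurable.enorm.aemeasurable).trans_eq ?_
    rw [eLpNorm_enorm, eLpNorm_enorm, stftNorm, hA]
    congr 1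
    exact eLpNorm_comp_measurePreserving (hm.aestronglyMeasurable)
      (measurePreserving_sub_right volume x)
  have hmeas : Measurable fun w : Rn n × Rn n => ‖decayWeight (n + 1) (ξ - w.2)‖ₑ *
        (‖decayWeight (n + 1) (w.1 - x)‖ₑ * ‖stft φ f w.1 w.2‖ₑ) := by
    refine (hm.comp (measurable_snd.const_sub ξ)).enorm.mul
      ((hm.comp (measurable_fst.sub_const x)).enorm.mul (continuous_stft φ f).measurable.enorm)
  rw [h1, enorm_mul]
  calc _ ≤ ENNReal.ofReal (inversionConst φ)⁻¹ * ∫⁻ w : Rn n × Rn n, ENNReal.ofReal C *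
        (‖decayWeight (n + 1) (ξ - w.2)‖ₑ *
        (‖decayWeight (n + 1) (w.1 - x)‖ₑ * ‖stft φ f w.1 w.2‖ₑ)) := by
        gcongr
        · rw [← ofReal_norm, Complex.norm_real, Real.norm_of_nonneg (by positivity)]
        · exact (enorm_integral_le_lintegral_enorm _).trans (lintegral_mono h2)
    _ = ENNReal.ofReal (inversionConst φ)⁻¹ * (ENNReal.ofReal C * ∫⁻ η,
          ‖decayWeight (n + 1) (ξ - η)‖ₑ * ∫⁻ y, ‖decayWeight (n + 1) (y - x)‖ₑ *
            ‖stft φ f y η‖ₑ) := by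
        rw [lintegral_const_mul _ hmeas, Measure.volume_eq_prod,
          lintegral_prod_symm _ hmeas.aemeasurable]
        congr 3
        ext η
        dsimp only
        rw [lintegral_const_mul]
        exact (hm.comp (measurable_id.sub_const x)).enorm.mul
          (continuous_stft_left φ f η).measurable.enorm
    _ ≤ ENNReal.ofReal (inversionConst φ)⁻¹ * (ENNReal.ofReal C * ∫⁻ η,
          ‖decayWeight (n + 1) (ξ - η)‖ₑ * (A * stftNorm φ p f η)) := by
        gcongr with η
        exact h3 η
    _ = _ := by
        rw [ENNReal.ofReal_mul (by positivity)]
        have : ∀ η, ‖decayWeight (n + 1) (ξ - η)‖ₑ * (A * stftNorm φ p f η) =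
          A * (‖decayWeight (n + 1) (ξ - η)‖ₑ * stftNorm φ p f η) := fun η => by ring
        simp only [this]
        rw [lintegral_const_mul' _ _ hAtop]
        ring

theorem modNorm_zero_top_one (φ : 𝓢(Rn n, ℂ)) (f : 𝓢'(Rn n, ℂ)) :
    modNorm φ 0 ∞ 1 f = ∫⁻ ξ, stftNorm φ ∞ f ξ := by
  simp [modNorm, stftNorm, eLpNorm_one_eq_lintegral_enorm]

/-- The pointwise bound does not depend on `x`, hence controls the essential supremum; Tonelli and
translation invariance then integrate out the convolution weight. -/
theorem exists_modNorm_zero_top_one_le {φ : 𝓢(Rn n, ℂ)} (hφ : φ ≠ 0) {p : ℝ≥0∞} (hp : 1 ≤ p) :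
    ∃ C : ℝ≥0∞, C ≠ ∞ ∧ ∀ f : 𝓢'(Rn n, ℂ), modNorm φ 0 ∞ 1 f ≤ C * ∫⁻ η, stftNorm φ p f η := by
  obtain ⟨C, hC, h⟩ := exists_enorm_stft_le hφ hp
  have hD := (lintegral_decayWeight_lt_top (Nat.lt_succ_self n)).ne
  refine ⟨C * ∫⁻ x : Rn n, ‖decayWeight (n + 1) x‖ₑ, ENNReal.mul_ne_top hC hD, fun f => ?_⟩
  have hm : Measurable (decayWeight (n := n) (n + 1)) := (continuous_decayWeight _).measurable
  rw [modNorm_zero_top_one]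
  calc _ ≤ ∫⁻ ξ, C * ∫⁻ η, ‖decayWeight (n + 1) (ξ - η)‖ₑ * stftNorm φ p f η := by
        refine lintegral_mono fun ξ => ?_
        rw [stftNorm, eLpNorm_exponent_top]
        exact essSup_le_of_ae_le _ (.of_forall fun x => h f x ξ)
    _ = C * ∫⁻ η, ∫⁻ ξ, ‖decayWeight (n + 1) (ξ - η)‖ₑ * stftNorm φ p f η := by
        rw [lintegral_const_mul' _ _ hC, lintegral_lintegral_swap]
        refine Measurable.aemeasurable ?_
        exact (hm.comp (measurable_fst.sub measurable_snd)).enorm.mul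
          ((measurable_stftNorm φ p f).comp measurable_snd)
    _ = C * ∫⁻ η, (∫⁻ x : Rn n, ‖decayWeight (n + 1) x‖ₑ) * stftNorm φ p f η := by
        congr 2
        ext η
        refine (lintegral_mul_const _ (hm.comp (measurable_id.sub_const η)).enorm).trans ?_
        congr 1
        exact lintegral_sub_right_eq_self (fun x => ‖decayWeight (n + 1) x‖ₑ) η
    _ = _ := by rw [lintegral_const_mul' _ _ hD, mul_assoc]

/-- The Japanese bracket `⟨ξ⟩ = (1 + |ξ|²)^{1/2}`. -/
def bracket (ξ : Rn n) : ℝ := Real.sqrt (1 + ‖ξ‖ ^ 2)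

theorem one_le_bracket (ξ : Rn n) : 1 ≤ bracket ξ :=
  Real.one_le_sqrt.2 (by nlinarith [sq_nonneg ‖ξ‖])

theorem bracket_pos (ξ : Rn n) : 0 < bracket ξ := one_pos.trans_le (one_le_bracket ξ)

theorem continuous_bracket_rpow (s : ℝ) : Continuous fun ξ : Rn n => bracket ξ ^ s := by
  refine Continuous.rpow_const ?_ fun ξ => .inl (bracket_pos ξ).ne'
  unfold bracket
  fun_prop

theorem enorm_bracket_rpow (s : ℝ) (ξ : Rn n) :
    ‖bracket ξ ^ s‖ₑ = ENNReal.ofReal (bracket ξ) ^ s := by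
  rw [Real.enorm_of_nonneg (by have := bracket_pos ξ; positivity),
    ENNReal.ofReal_rpow_of_pos (bracket_pos ξ)]

theorem lintegral_bracket_rpow_lt_top {r : ℝ} (hr : n < r) :
    ∫⁻ ξ : Rn n, ‖bracket ξ ^ (-r)‖ₑ < ∞ := by
  have h := integrable_rpow_neg_one_add_norm_sq (E := Rn n) (μ := volume) (r := r)
    (by rwa [finrank_euclideanSpace_fin])
  refine lt_of_eq_of_lt ?_ h.hasFiniteIntegral
  congr 1
  ext ξ
  rw [bracket, Real.sqrt_eq_rpow, ← Real.rpow_mul (by positivity)]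
  congr 2
  ring

theorem bracket_rpow_le_one {r : ℝ} (hr : r ≤ 0) (ξ : Rn n) : bracket ξ ^ r ≤ 1 :=
  Real.rpow_le_one_of_one_le_of_nonpos (one_le_bracket ξ) hr

theorem eLpNorm_top_bracket_rpow_le_one {r : ℝ} (hr : r ≤ 0) :
    eLpNorm (fun ξ : Rn n => bracket ξ ^ r) ∞ volume ≤ 1 := by
  rw [eLpNorm_exponent_top]
  refine (eLpNormEssSup_le_of_ae_bound (C := 1) (.of_forall fun x => ?_)).trans_eq
    ENNReal.ofReal_one
  rw [Real.norm_of_nonneg (by have := bracket_pos x; positivity)]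
  exact bracket_rpow_le_one hr x

theorem eLpNorm_bracket_rpow_lt_top {s : ℝ} {q : ℝ≥0∞} (hq : 1 ≤ q)
    (h : (0 ≤ s ∧ q = ∞) ∨ (n : ℝ) * (1 / q).toReal < s) :
    eLpNorm (fun ξ : Rn n => bracket ξ ^ (-s)) q volume < ∞ := by
  rcases eq_or_ne q ∞ with rfl | hq'
  · have hs : 0 ≤ s := by
      rcases h with h | h
      · exact h.1
      · simpa using h.le
    exact (eLpNorm_top_bracket_rpow_le_one (by linarith)).trans_lt ENNReal.one_lt_top
  · have h : (n : ℝ) * (1 / q).toReal < s := h.resolve_left fun h => hq' h.2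
    have hq0 : 0 < q.toReal := ENNReal.toReal_pos (by positivity) hq'
    rw [eLpNorm_lt_top_iff_lintegral_rpow_enorm_lt_top (by positivity) hq']
    have hr : n < s * q.toReal := by
      rw [one_div, ENNReal.toReal_inv, ← div_eq_mul_inv, div_lt_iff₀ hq0] at h
      exact h
    refine lt_of_eq_of_lt ?_ (lintegral_bracket_rpow_lt_top hr)
    congr 1
    ext ξ
    rw [enorm_bracket_rpow, enorm_bracket_rpow, ← ENNReal.rpow_mul, neg_mul]

theorem modNorm_eq (φ : 𝓢(Rn n, ℂ)) (s : ℝ) (p q : ℝ≥0∞) (f : 𝓢'(Rn n, ℂ)) :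
    modNorm φ s p q f =
      eLpNorm (fun ξ : Rn n => ‖bracket ξ ^ s‖ₑ * stftNorm φ p f ξ) q volume := by
  rw [modNorm]
  congr 1
  ext ξ
  exact eLpNorm_const_smul (bracket ξ ^ s) (fun x => stft φ f x ξ) p volume

/-- Hölder in frequency after inserting `1 = ⟨ξ⟩^{-s} ⟨ξ⟩^s`. -/
theorem lintegral_stftNorm_le (φ : 𝓢(Rn n, ℂ)) (s : ℝ) (p q q' : ℝ≥0∞) [q'.HolderConjugate q]
    (f : 𝓢'(Rn n, ℂ)) : ∫⁻ ξ, stftNorm φ p f ξ ≤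
      eLpNorm (fun ξ : Rn n => bracket ξ ^ (-s)) q' volume * modNorm φ s p q f := by
  rw [modNorm_eq, ← eLpNorm_enorm (fun ξ : Rn n => bracket ξ ^ (-s))]
  refine le_trans (lintegral_mono fun ξ => ?_) (lintegral_mul_le_eLpNorm_mul_eLpNorm
    (continuous_bracket_rpow (-s)).measurable.enorm.aemeasurable
    ((continuous_bracket_rpow s).measurable.enorm.mul (measurable_stftNorm φ p f)).aemeasurable)
  rw [← mul_assoc, ← enorm_mul, ← Real.rpow_add (bracket_pos ξ)]
  simp

/-- `M^s_{p,q} ↪ M^0_{∞,1}` when `s` is large enough. -/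
theorem continuouslyEmbeds_modNorm_zero_top_one {φ : 𝓢(Rn n, ℂ)} (hφ : φ ≠ 0) {s : ℝ}
    {p q q' : ℝ≥0∞} (hp : 1 ≤ p) (hq' : 1 / q + 1 / q' = 1)
    (h : (0 ≤ s ∧ q = 1) ∨ (n : ℝ) * (1 / q').toReal < s) :
    ContinuouslyEmbeds (modNorm φ s p q) (modNorm φ 0 ∞ 1) := by
  have hol : q'.HolderConjugate q := by
    rw [ENNReal.holderConjugate_iff, ← hq']
    simp [add_comm]
  have h1 : 1 ≤ q' := ENNReal.HolderConjugate.one_le q' q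
  have hB : eLpNorm (fun ξ : Rn n => bracket ξ ^ (-s)) q' volume < ∞ := by
    refine eLpNorm_bracket_rpow_lt_top h1 (h.imp_left fun h => ⟨h.1, ?_⟩)
    obtain ⟨-, rfl⟩ := h
    exact ENNReal.HolderConjugate.unique 1 q' ∞
  obtain ⟨C, hC, hle⟩ := exists_modNorm_zero_top_one_le hφ hp
  refine ⟨(C * eLpNorm (fun ξ : Rn n => bracket ξ ^ (-s)) q' volume).toNNReal, fun f _ => ?_⟩
  rw [ENNReal.coe_toNNReal (ENNReal.mul_ne_top hC hB.ne), mul_assoc]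
  exact (hle f).trans (mul_le_mul_right (lintegral_stftNorm_le φ s p q q' f) _)

end ModulationSpace

/-! ### From `M^0_{∞,1}` to bounded uniformly continuous functions -/

namespace ModulationSpace

variable {n : ℕ}

/-- The bound holds on a closed set of full measure, and such a set is dense, hence everything. -/
theorem _root_.Continuous.enorm_le_eLpNorm_top {X E : Type*} [TopologicalSpace X]
    [MeasurableSpace X] {μ : Measure X} [μ.IsOpenPosMeasure] [NormedAddCommGroup E] {h : X → E}
    (hh : Continuous h) (x : X) : ‖h x‖ₑ ≤ eLpNorm h ∞ μ := by
  have hcl : IsClosed {y | ‖h y‖ₑ ≤ eLpNorm h ∞ μ} := isClosed_le hh.enorm continuous_const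
  have hae : ∀ᵐ y ∂μ, ‖h y‖ₑ ≤ eLpNorm h ∞ μ := by
    rw [eLpNorm_exponent_top]
    exact ae_le_eLpNormEssSup
  have hd : Dense {y | ‖h y‖ₑ ≤ eLpNorm h ∞ μ} := Measure.dense_of_ae hae
  have := hd.closure_eq
  rw [hcl.closure_eq] at this
  exact this.ge (Set.mem_univ x)

theorem enorm_stft_le_stftNorm (φ : 𝓢(Rn n, ℂ)) (f : 𝓢'(Rn n, ℂ)) (x ξ : Rn n) :
    ‖stft φ f x ξ‖ₑ ≤ stftNorm φ ∞ f ξ :=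
  (continuous_stft_left φ f ξ).enorm_le_eLpNorm_top x

/-- The integrand of the synthesis formula recovering `f` from its short-time Fourier transform. -/
def synthesisKernel (φ : 𝓢(Rn n, ℂ)) (f : 𝓢'(Rn n, ℂ)) (t : Rn n) (w : Rn n × Rn n) : ℂ :=
  modTranslate φ w.1 (-w.2) t * stft φ f w.1 w.2

theorem continuous_synthesisKernel (φ : 𝓢(Rn n, ℂ)) (f : 𝓢'(Rn n, ℂ)) :
    Continuous fun z : (Rn n × Rn n) × Rn n => synthesisKernel φ f z.2 z.1 := by
  simp only [synthesisKernel, modTranslate_apply]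
  have h1 : Continuous fun z : (Rn n × Rn n) × Rn n => stft φ f z.1.1 z.1.2 :=
    (continuous_stft φ f).comp continuous_fst
  have h2 : Continuous fun z : (Rn n × Rn n) × Rn n => φ (z.2 - z.1.1) :=
    φ.continuous.comp (by fun_prop)
  exact ((by fun_prop : Continuous fun z : (Rn n × Rn n) × Rn n =>
    Complex.exp (-Complex.I * ((inner ℝ z.2 (-z.1.2) : ℝ) : ℂ))).mul h2).mul h1

theorem continuous_synthesisKernel_right (φ : 𝓢(Rn n, ℂ)) (f : 𝓢'(Rn n, ℂ)) (t : Rn n) :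
    Continuous (synthesisKernel φ f t) := by
  have h := (continuous_synthesisKernel φ f).comp (Continuous.prodMk_left t)
  simpa only [Function.comp_def] using h

theorem lintegral_enorm_synthesisKernel_le (φ : 𝓢(Rn n, ℂ)) (f : 𝓢'(Rn n, ℂ)) (t : Rn n) :
    ∫⁻ w, ‖synthesisKernel φ f t w‖ₑ ≤ (∫⁻ x, ‖φ x‖ₑ) * ∫⁻ η, stftNorm φ ∞ f η := by
  have hm : Measurable fun y => ‖φ (t - y)‖ₑ :=
    (φ.continuous.measurable.comp (measurable_id.const_sub t)).enorm
  calc _ ≤ ∫⁻ w : Rn n × Rn n, ‖φ (t - w.1)‖ₑ * stftNorm φ ∞ f w.2 := by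
        refine lintegral_mono fun w => ?_
        rw [synthesisKernel, enorm_mul]
        refine mul_le_mul' (le_of_eq ?_) (enorm_stft_le_stftNorm φ f _ _)
        rw [← ofReal_norm, norm_modTranslate, ofReal_norm]
    _ = (∫⁻ y, ‖φ (t - y)‖ₑ) * ∫⁻ η, stftNorm φ ∞ f η := by
        rw [Measure.volume_eq_prod]
        exact lintegral_prod_mul hm.aemeasurable (measurable_stftNorm φ ∞ f).aemeasurable
    _ = _ := by
        rw [lintegral_sub_left_eq_self (fun y => ‖φ y‖ₑ) t]

theorem lintegral_enorm_schwartz_lt_top (φ : 𝓢(Rn n, ℂ)) : ∫⁻ x, ‖φ x‖ₑ < ∞ :=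
  (φ.integrable (μ := volume)).hasFiniteIntegral

theorem integrable_synthesisKernel (φ : 𝓢(Rn n, ℂ)) {f : 𝓢'(Rn n, ℂ)}
    (hf : ∫⁻ η, stftNorm φ ∞ f η < ∞) (t : Rn n) : Integrable (synthesisKernel φ f t) :=
  ⟨(continuous_synthesisKernel_right φ f t).aestronglyMeasurable,
    (lintegral_enorm_synthesisKernel_le φ f t).trans_lt
      (ENNReal.mul_lt_top (lintegral_enorm_schwartz_lt_top φ) hf)⟩

/-- The modulus of continuity of functions in `M^0_{∞,1}`. -/
def synthesisModulus (φ : 𝓢(Rn n, ℂ)) (f : 𝓢'(Rn n, ℂ)) (h : Rn n) : ℝ≥0∞ :=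
  ∫⁻ w : Rn n × Rn n, ‖Complex.exp (-Complex.I * ((inner ℝ h (-w.2) : ℝ) : ℂ)) * φ (w.1 + h) -
    φ w.1‖ₑ * stftNorm φ ∞ f w.2

theorem continuous_exp_mul_translate_sub (φ : 𝓢(Rn n, ℂ)) :
    Continuous fun z : (Rn n × Rn n) × Rn n => Complex.exp (-Complex.I *
      ((inner ℝ z.2 (-z.1.2) : ℝ) : ℂ)) * φ (z.1.1 + z.2) - φ z.1.1 := by
  have h1 : Continuous fun z : (Rn n × Rn n) × Rn n => φ z.1.1 :=
    φ.continuous.comp (by fun_prop)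
  have h2 : Continuous fun z : (Rn n × Rn n) × Rn n => φ (z.1.1 + z.2) :=
    φ.continuous.comp (by fun_prop)
  exact ((by fun_prop : Continuous fun z : (Rn n × Rn n) × Rn n =>
    Complex.exp (-Complex.I * ((inner ℝ z.2 (-z.1.2) : ℝ) : ℂ))).mul h2).sub h1

theorem measurable_exp_mul_translate_sub (φ : 𝓢(Rn n, ℂ)) (h : Rn n) :
    Measurable fun w : Rn n × Rn n => ‖Complex.exp (-Complex.I *
      ((inner ℝ h (-w.2) : ℝ) : ℂ)) * φ (w.1 + h) - φ w.1‖ₑ := by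
  have h1 := (continuous_exp_mul_translate_sub φ).comp (Continuous.prodMk_left h)
  simp only [Function.comp_def] at h1
  exact h1.measurable.enorm

theorem enorm_integral_synthesisKernel_sub_le (φ : 𝓢(Rn n, ℂ)) {f : 𝓢'(Rn n, ℂ)}
    (hf : ∫⁻ η, stftNorm φ ∞ f η < ∞) (t h : Rn n) :
    ‖(∫ w, synthesisKernel φ f (t + h) w) - ∫ w, synthesisKernel φ f t w‖ₑ ≤
      synthesisModulus φ f h := by
  rw [← integral_sub (integrable_synthesisKernel φ hf _) (integrable_synthesisKernel φ hf _)]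
  refine (enorm_integral_le_lintegral_enorm _).trans ?_
  have hpt : ∀ w : Rn n × Rn n,
      ‖synthesisKernel φ f (t + h) w - synthesisKernel φ f t w‖ₑ ≤
      ‖Complex.exp (-Complex.I * ((inner ℝ h (-w.2) : ℝ) : ℂ)) * φ ((t - w.1) + h) -
        φ (t - w.1)‖ₑ * stftNorm φ ∞ f w.2 := by
    intro w
    have e : synthesisKernel φ f (t + h) w - synthesisKernel φ f t w =
        Complex.exp (((inner ℝ t w.2 : ℝ) : ℂ) * Complex.I) *
        ((Complex.exp (-Complex.I * ((inner ℝ h (-w.2) : ℝ) : ℂ)) * φ ((t - w.1) + h) -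
        φ (t - w.1)) * stft φ f w.1 w.2) := by
      have e1 : Complex.exp (-Complex.I * ((inner ℝ (t + h) (-w.2) : ℝ) : ℂ)) =
          Complex.exp (((inner ℝ t w.2 : ℝ) : ℂ) * Complex.I) *
            Complex.exp (-Complex.I * ((inner ℝ h (-w.2) : ℝ) : ℂ)) := by
        rw [← Complex.exp_add, inner_add_left, inner_neg_right, inner_neg_right]
        congr 1
        push_cast
        ring
      have e2 : Complex.exp (-Complex.I * ((inner ℝ t (-w.2) : ℝ) : ℂ)) =
          Complex.exp (((inner ℝ t w.2 : ℝ) : ℂ) * Complex.I) := by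
        rw [inner_neg_right]
        congr 1
        push_cast
        ring
      rw [synthesisKernel, synthesisKernel, modTranslate_apply, modTranslate_apply, e1, e2,
        show t + h - w.1 = t - w.1 + h by abel]
      ring
    rw [e, enorm_mul, ← ofReal_norm, Complex.norm_exp_ofReal_mul_I, ENNReal.ofReal_one, one_mul,
      enorm_mul]
    gcongr
    exact enorm_stft_le_stftNorm φ f _ _
  refine (lintegral_mono hpt).trans_eq ?_
  -- Reflecting the time variable by `y ↦ t - y` removes `t`, which makes the modulus of continuity
  -- uniform.
  have hmp : MeasurePreserving (Prod.map (fun y : Rn n => t - y) (id : Rn n → Rn n))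
      (volume.prod volume) (volume.prod volume) :=
    (Measure.measurePreserving_sub_left volume t).prod (MeasurePreserving.id volume)
  have hm : Measurable fun w : Rn n × Rn n => ‖Complex.exp (-Complex.I *
      ((inner ℝ h (-w.2) : ℝ) : ℂ)) * φ (w.1 + h) - φ w.1‖ₑ * stftNorm φ ∞ f w.2 :=
    (measurable_exp_mul_translate_sub φ h).mul
      ((measurable_stftNorm φ ∞ f).comp measurable_snd)
  exact hmp.lintegral_comp hm

theorem tendsto_synthesisModulus (φ : 𝓢(Rn n, ℂ)) {f : 𝓢'(Rn n, ℂ)}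
    (hf : ∫⁻ η, stftNorm φ ∞ f η < ∞) :
    Filter.Tendsto (synthesisModulus φ f) (nhds 0) (nhds 0) := by
  obtain ⟨C, hC, hφ⟩ := norm_mul_le_decayWeight φ (n + 1)
  have hm : Measurable fun w : Rn n × Rn n => stftNorm φ ∞ f w.2 :=
    (measurable_stftNorm φ ∞ f).comp measurable_snd
  have hfin : ∀ᵐ η : Rn n, stftNorm φ ∞ f η < ∞ :=
    ae_lt_top (measurable_stftNorm φ ∞ f) hf.ne
  have h0 : ∫⁻ w : Rn n × Rn n, (0 : ℝ≥0∞) = 0 := lintegral_zero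
  rw [← h0]
  refine tendsto_lintegral_filter_of_dominated_convergence
    (fun w : Rn n × Rn n => (ENNReal.ofReal (C * 2 ^ (n + 1) + C) * ‖decayWeight (n + 1) w.1‖ₑ) *
      stftNorm φ ∞ f w.2)
    (.of_forall fun h => (measurable_exp_mul_translate_sub φ h).mul hm) ?_ ?_ ?_
  -- For `‖h‖ < 1` one has `1 + ‖x‖ ≤ 2 (1 + ‖x + h‖)`, so the translated window obeys the same
  -- decay up to `2 ^ (n + 1)`.
  · filter_upwards [Metric.ball_mem_nhds (0 : Rn n) one_pos] with h hh
    refine .of_forall fun w => ?_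
    rw [mem_ball_zero_iff] at hh
    gcongr
    rw [enorm_decayWeight, ← ENNReal.ofReal_mul (by positivity), ← ofReal_norm]
    refine ENNReal.ofReal_le_ofReal ?_
    have h1 : decayWeight (n + 1) (w.1 + h) ≤ 2 ^ (n + 1) * decayWeight (n + 1) w.1 := by
      have hw := norm_nonneg w.1
      rw [decayWeight, decayWeight, ← div_eq_mul_inv, le_div_iff₀ (by positivity), mul_comm,
        ← div_eq_mul_inv, div_le_iff₀ (by positivity), ← mul_pow]
      refine pow_le_pow_left₀ (by positivity) ?_ _
      have := norm_sub_le (w.1 + h) h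
      rw [add_sub_cancel_right] at this
      have := norm_nonneg (w.1 + h)
      linarith
    calc _ ≤ ‖φ (w.1 + h)‖ + ‖φ w.1‖ := by
          refine (norm_sub_le _ _).trans_eq ?_
          rw [norm_mul, Complex.norm_exp]
          simp
      _ ≤ C * (2 ^ (n + 1) * decayWeight (n + 1) w.1) + C * decayWeight (n + 1) w.1 :=
          add_le_add ((hφ _).trans (by gcongr)) (hφ _)
      _ = _ := by ring
  · rw [Measure.volume_eq_prod, lintegral_prod_mul
      ((continuous_decayWeight _).measurable.enorm.const_mul _).aemeasurable
      (measurable_stftNorm φ ∞ f).aemeasurable, lintegral_const_mul' _ _ ENNReal.ofReal_ne_top]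
    exact (ENNReal.mul_lt_top (ENNReal.mul_lt_top ENNReal.ofReal_lt_top
      (lintegral_decayWeight_lt_top (Nat.lt_succ_self n))) hf).ne
  -- The factor `stftNorm` must be finite for its product with a null factor to tend to zero;
  -- integrability gives this almost everywhere.
  · have hfin' : ∀ᵐ w : Rn n × Rn n, stftNorm φ ∞ f w.2 < ∞ := by
      rw [Measure.volume_eq_prod]
      exact Measure.quasiMeasurePreserving_snd.ae hfin
    filter_upwards [hfin'] with w hw
    have hc : Continuous fun h : Rn n => ‖Complex.exp (-Complex.I *
        ((inner ℝ h (-w.2) : ℝ) : ℂ)) * φ (w.1 + h) - φ w.1‖ₑ := by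
      have h1 := (continuous_exp_mul_translate_sub φ).comp (Continuous.prodMk_right w)
      simp only [Function.comp_def] at h1
      exact h1.enorm
    have hl := hc.tendsto 0
    simp only [inner_zero_left, Complex.ofReal_zero, mul_zero, Complex.exp_zero, one_mul, add_zero,
      sub_self, enorm_zero] at hl
    have := ENNReal.Tendsto.mul_const hl (.inr hw.ne)
    simpa using this

/-- The function representing a tempered distribution in `M^0_{∞,1}`, up to normalisation. -/
def synthesis (φ : 𝓢(Rn n, ℂ)) (f : 𝓢'(Rn n, ℂ)) (t : Rn n) : ℂ := ∫ w, synthesisKernel φ f t w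

theorem enorm_synthesis_le (φ : 𝓢(Rn n, ℂ)) (f : 𝓢'(Rn n, ℂ)) (t : Rn n) :
    ‖synthesis φ f t‖ₑ ≤ (∫⁻ x, ‖φ x‖ₑ) * ∫⁻ η, stftNorm φ ∞ f η :=
  (enorm_integral_le_lintegral_enorm _).trans (lintegral_enorm_synthesisKernel_le φ f t)

theorem uniformContinuous_synthesis (φ : 𝓢(Rn n, ℂ)) {f : 𝓢'(Rn n, ℂ)}
    (hf : ∫⁻ η, stftNorm φ ∞ f η < ∞) : UniformContinuous (synthesis φ f) := by
  rw [EMetric.uniformContinuous_iff]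
  intro ε hε
  obtain ⟨δ, hδ, h⟩ := Metric.nhds_basis_eball.eventually_iff.1
    ((tendsto_synthesisModulus φ hf).eventually_lt_const hε)
  refine ⟨δ, hδ, fun {a b} hab => ?_⟩
  have h1 := enorm_integral_synthesisKernel_sub_le φ hf b (a - b)
  rw [add_sub_cancel] at h1
  rw [edist_eq_enorm_sub]
  refine h1.trans_lt (h ?_)
  rw [Metric.mem_eball, edist_zero_right, ← edist_eq_enorm_sub]
  exact hab

/-- Fubini turns the pairing of the synthesis integral with `u` into the right-hand side of the
inversion formula, which identifies the represented distribution. -/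
theorem integral_synthesis_mul (φ u : 𝓢(Rn n, ℂ)) {f : 𝓢'(Rn n, ℂ)}
    (hf : ∫⁻ η, stftNorm φ ∞ f η < ∞) :
    ∫ t, synthesis φ f t * u t =
      ∫ w : Rn n × Rn n, crossSTFT u φ w.1 (-w.2) * stft φ f w.1 w.2 := by
  have e1 : ∀ t, synthesis φ f t * u t = ∫ w, synthesisKernel φ f t w * u t := fun t =>
    (integral_mul_const _ _).symm
  have e2 : ∀ w : Rn n × Rn n, crossSTFT u φ w.1 (-w.2) * stft φ f w.1 w.2 =
      ∫ t, synthesisKernel φ f t w * u t := by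
    intro w
    rw [crossSTFT, ← integral_mul_const]
    congr 1
    ext t
    rw [synthesisKernel]; ring
  simp only [e1, e2]
  refine (integral_integral_swap ?_).symm
  have hc : Continuous fun z : (Rn n × Rn n) × Rn n => synthesisKernel φ f z.2 z.1 * u z.2 :=
    (continuous_synthesisKernel φ f).mul (u.continuous.comp continuous_snd)
  refine ⟨hc.aestronglyMeasurable, ?_⟩
  rw [hasFiniteIntegral_iff_enorm]
  have hm : Measurable fun z : (Rn n × Rn n) × Rn n => ‖synthesisKernel φ f z.2 z.1 * u z.2‖ₑ :=
    hc.measurable.enorm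
  refine (lintegral_prod_symm _ hm.aemeasurable).trans_lt ?_
  calc _ ≤ ∫⁻ t, ((∫⁻ x, ‖φ x‖ₑ) * ∫⁻ η, stftNorm φ ∞ f η) * ‖u t‖ₑ := by
        refine lintegral_mono fun t => ?_
        simp only [enorm_mul]
        rw [lintegral_mul_const' _ _ enorm_ne_top]
        gcongr
        exact lintegral_enorm_synthesisKernel_le φ f t
    _ < ∞ := by
        have hA := ENNReal.mul_lt_top (lintegral_enorm_schwartz_lt_top φ) hf
        rw [lintegral_const_mul' _ _ hA.ne]
        exact ENNReal.mul_lt_top hA (lintegral_enorm_schwartz_lt_top u)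

/-- `M^0_{∞,1} ↪ C_{ub}`. -/
theorem exists_cubNorm_le {φ : 𝓢(Rn n, ℂ)} (hφ : φ ≠ 0) :
    ∃ C : ℝ≥0∞, C ≠ ∞ ∧ ∀ f : 𝓢'(Rn n, ℂ), modNorm φ 0 ∞ 1 f < ∞ →
      cubNorm f ≤ C * modNorm φ 0 ∞ 1 f := by
  set κ : ℝ := (2 * Real.pi) ^ (-(n : ℝ) / 2) * inversionConst φ with hκ
  have hκ0 : 0 < κ := mul_pos (by positivity) (inversionConst_pos hφ)
  refine ⟨ENNReal.ofReal κ⁻¹ * ∫⁻ x, ‖φ x‖ₑ, ENNReal.mul_ne_top ENNReal.ofReal_ne_top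
    (lintegral_enorm_schwartz_lt_top φ).ne, fun f hf => ?_⟩
  rw [modNorm_zero_top_one] at hf ⊢
  have hB : ENNReal.ofReal κ⁻¹ * ((∫⁻ x, ‖φ x‖ₑ) * ∫⁻ η, stftNorm φ ∞ f η) ≠ ∞ :=
    ENNReal.mul_ne_top ENNReal.ofReal_ne_top
      (ENNReal.mul_lt_top (lintegral_enorm_schwartz_lt_top φ) hf).ne
  have hle : ∀ t, ‖((κ⁻¹ : ℝ) : ℂ) * synthesis φ f t‖ₑ ≤
      ENNReal.ofReal κ⁻¹ * ((∫⁻ x, ‖φ x‖ₑ) * ∫⁻ η, stftNorm φ ∞ f η) := by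
    intro t
    rw [enorm_mul]
    refine mul_le_mul' (le_of_eq ?_) (enorm_synthesis_le φ f t)
    rw [← ofReal_norm, Complex.norm_real, Real.norm_of_nonneg (by positivity)]
  have huc : UniformContinuous fun t => ((κ⁻¹ : ℝ) : ℂ) * synthesis φ f t :=
    
    (uniformContinuous_synthesis φ hf).const_smul ((κ⁻¹ : ℝ) : ℂ)
  let g : Rn n →ᵇ ℂ := BoundedContinuousFunction.ofNormedAddCommGroup
    (fun t => ((κ⁻¹ : ℝ) : ℂ) * synthesis φ f t) huc.continuous
    (ENNReal.ofReal κ⁻¹ * ((∫⁻ x, ‖φ x‖ₑ) * ∫⁻ η, stftNorm φ ∞ f η)).toReal (fun t => by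
      rw [← toReal_enorm]
      exact ENNReal.toReal_mono hB (hle t))
  have hg : ‖g‖ₑ ≤ ENNReal.ofReal κ⁻¹ * ((∫⁻ x, ‖φ x‖ₑ) * ∫⁻ η, stftNorm φ ∞ f η) := by
    rw [← ofReal_norm]
    exact ENNReal.ofReal_le_of_le_toReal
      (BoundedContinuousFunction.norm_ofNormedAddCommGroup_le _ ENNReal.toReal_nonneg _)
  rw [mul_assoc]
  refine le_trans ?_ hg
  refine iInf_le_of_le g (iInf_le_of_le huc (iInf_le_of_le (fun u => ?_) le_rfl))
  have h1 : ∀ t, g t * u t = ((κ⁻¹ : ℝ) : ℂ) * (synthesis φ f t * u t) := fun t => mul_assoc _ _ _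
  simp only [h1]
  rw [integral_const_mul, integral_synthesis_mul φ u hf, ← inversionConst_mul_apply_stft,
    ← mul_assoc, ← mul_assoc, mul_assoc _ (_ : ℂ) ((inversionConst φ : ℝ) : ℂ), ← Complex.ofReal_mul,
    ← hκ, ← Complex.ofReal_mul, inv_mul_cancel₀ hκ0.ne', Complex.ofReal_one, one_mul]

theorem linftyNorm_le_cubNorm (f : 𝓢'(Rn n, ℂ)) : linftyNorm f ≤ cubNorm f := by
  refine le_iInf fun g => le_iInf fun _ => le_iInf fun hg => ?_
  have hmem : MemLp g ∞ (volume : Measure (Rn n)) :=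
    memLp_top_of_bound g.continuous.aestronglyMeasurable ‖g‖ (.of_forall g.norm_coe_le_norm)
  refine iInf_le_of_le hmem.toLp (iInf_le_of_le ?_ ?_)
  · ext u
    rw [Lp.toTemperedDistribution_apply, hg u]
    refine integral_congr_ae ?_
    filter_upwards [hmem.coeFn_toLp] with x hx
    rw [hx, smul_eq_mul, mul_comm]
  · rw [Lp.enorm_toLp, eLpNorm_exponent_top, ← ofReal_norm]
    exact eLpNormEssSup_le_of_ae_bound (.of_forall g.norm_coe_le_norm)

end ModulationSpace

/-! ### Necessity: the test distributions and their norms -/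

namespace ModulationSpace

variable {n : ℕ}

theorem integrable_bracket_rpow {r : ℝ} (hr : n < r) :
    Integrable fun ξ : Rn n => bracket ξ ^ (-r) :=
  ⟨(continuous_bracket_rpow _).aestronglyMeasurable, lintegral_bracket_rpow_lt_top hr⟩

theorem bracket_le_mul (ξ η : Rn n) : bracket ξ ≤ bracket η * (1 + ‖ξ - η‖) := by
  have h1 : ‖ξ‖ ≤ ‖η‖ + ‖ξ - η‖ := by
    simpa using norm_add_le η (ξ - η)
  have hη := norm_nonneg η
  have hd := norm_nonneg (ξ - η)
  have hξ := norm_nonneg ξ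
  rw [bracket, bracket]
  refine Real.sqrt_le_iff.2 ⟨by positivity, ?_⟩
  rw [mul_pow, Real.sq_sqrt (by positivity)]
  have h2 : ‖ξ‖ ^ 2 ≤ (‖η‖ + ‖ξ - η‖) ^ 2 := pow_le_pow_left₀ hξ h1 2
  nlinarith [mul_nonneg hd (sq_nonneg (‖η‖ - 1)), mul_nonneg hd (sq_nonneg ‖η‖),
    mul_nonneg (sq_nonneg ‖ξ - η‖) (sq_nonneg ‖η‖)]

/-- A Peetre-type inequality raised to the power `r`. The cap `r ≤ n + 1` keeps the loss in `1 + ‖ξ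
- η‖` independent of `r`, so that later constants are uniform as `r` approaches `n`. -/
theorem bracket_rpow_neg_mul_decayWeight_le {r : ℝ} (hr0 : 0 ≤ r) (hr : r ≤ n + 1) (ξ η : Rn n) :
    bracket η ^ (-r) * decayWeight (2 * (n + 1)) (ξ - η) ≤
      bracket ξ ^ (-r) * decayWeight (n + 1) (ξ - η) := by
  have hd := norm_nonneg (ξ - η)
  have hη := bracket_pos η
  have hξ := bracket_pos ξ
  have h1 : bracket ξ ^ r ≤ bracket η ^ r * (1 + ‖ξ - η‖) ^ (n + 1) := by
    calc bracket ξ ^ r ≤ (bracket η * (1 + ‖ξ - η‖)) ^ r := by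
          gcongr
          exact bracket_le_mul ξ η
      _ = bracket η ^ r * (1 + ‖ξ - η‖) ^ r := Real.mul_rpow hη.le (by positivity)
      _ ≤ bracket η ^ r * (1 + ‖ξ - η‖) ^ (n + 1) := by
          gcongr
          rw [← Real.rpow_natCast]
          refine Real.rpow_le_rpow_of_exponent_le (by linarith) ?_
          push_cast
          exact hr
  have e : decayWeight (2 * (n + 1)) (ξ - η) =
      decayWeight (n + 1) (ξ - η) * ((1 + ‖ξ - η‖) ^ (n + 1))⁻¹ := by
    simp only [decayWeight, two_mul, pow_add, mul_inv]
  rw [e, Real.rpow_neg hη.le, Real.rpow_neg hξ.le]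
  have hD := decayWeight_pos (n + 1) (ξ - η)
  have h2 : (bracket η ^ r)⁻¹ * ((1 + ‖ξ - η‖) ^ (n + 1))⁻¹ ≤ (bracket ξ ^ r)⁻¹ := by
    rw [← mul_inv]
    exact inv_anti₀ (by positivity) h1
  calc _ = ((bracket η ^ r)⁻¹ * ((1 + ‖ξ - η‖) ^ (n + 1))⁻¹) * decayWeight (n + 1) (ξ - η) := by
        ring
    _ ≤ _ := by gcongr

/-- The inverse Fourier transform of `⟨η⟩^{-r}`, cut off by the Schwartz function `ψ`. -/
def testFunction (ψ : 𝓢(Rn n, ℂ)) (r : ℝ) (t : Rn n) : ℂ :=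
  ψ t * ∫ η, Complex.exp (((inner ℝ t η : ℝ) : ℂ) * Complex.I) * ((bracket η ^ (-r) : ℝ) : ℂ)

theorem continuous_testFunction (ψ : 𝓢(Rn n, ℂ)) {r : ℝ} (hr : n < r) :
    Continuous (testFunction ψ r) := by
  refine ψ.continuous.mul ?_
  refine continuous_of_dominated (bound := fun η : Rn n => bracket η ^ (-r)) (fun t => ?_)
    (fun t => .of_forall fun η => ?_) (integrable_bracket_rpow hr) (.of_forall fun η => ?_)
  · refine Continuous.aestronglyMeasurable ?_
    exact (by fun_prop : Continuous fun η : Rn n =>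
      Complex.exp (((inner ℝ t η : ℝ) : ℂ) * Complex.I)).mul
      (Complex.continuous_ofReal.comp (continuous_bracket_rpow (-r)))
  · rw [norm_mul, Complex.norm_exp_ofReal_mul_I, one_mul, Complex.norm_real,
      Real.norm_of_nonneg (by have := bracket_pos η; positivity)]
  · fun_prop

theorem memLp_testFunction (ψ : 𝓢(Rn n, ℂ)) {r : ℝ} (hr : n < r) :
    MemLp (testFunction ψ r) ∞ (volume : Measure (Rn n)) := by
  refine memLp_top_of_bound (continuous_testFunction ψ hr).aestronglyMeasurable
    (SchwartzMap.seminorm ℝ 0 0 ψ * ∫ η : Rn n, bracket η ^ (-r)) (.of_forall fun t => ?_)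
  rw [testFunction, norm_mul]
  refine mul_le_mul (SchwartzMap.norm_le_seminorm ℝ ψ t) ?_ (norm_nonneg _) (apply_nonneg _ _)
  refine (norm_integral_le_integral_norm _).trans_eq ?_
  congr 1
  ext η
  rw [norm_mul, Complex.norm_exp_ofReal_mul_I, one_mul, Complex.norm_real,
    Real.norm_of_nonneg (by have := bracket_pos η; positivity)]

/-- `testFunction` as a tempered distribution. -/
def testDistribution (ψ : 𝓢(Rn n, ℂ)) {r : ℝ} (hr : n < r) : 𝓢'(Rn n, ℂ) :=
  Lp.toTemperedDistribution (memLp_testFunction ψ hr).toLp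

theorem testDistribution_apply (ψ : 𝓢(Rn n, ℂ)) {r : ℝ} (hr : n < r) (u : 𝓢(Rn n, ℂ)) :
    testDistribution ψ hr u = ∫ t, u t * testFunction ψ r t := by
  rw [testDistribution, Lp.toTemperedDistribution_apply]
  refine integral_congr_ae ?_
  filter_upwards [(memLp_testFunction ψ hr).coeFn_toLp] with x hx
  rw [hx, smul_eq_mul]

/-- The test function is continuous, so its essential supremum dominates its value at the origin,
where all phases are `1` and the integral is the full mass of `⟨η⟩^{-r}`. -/
theorem linftyNorm_testDistribution_ge {ψ : 𝓢(Rn n, ℂ)} (hψ : ψ 0 = 1) {r : ℝ} (hr : n < r) :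
    ∫⁻ η : Rn n, ‖bracket η ^ (-r)‖ₑ ≤ linftyNorm (testDistribution ψ hr) := by
  refine le_iInf fun g => le_iInf fun hg => ?_
  have hg' : g = (memLp_testFunction ψ hr).toLp := by
    -- Only one element of `L_∞` can represent the distribution: the map from `L_∞` to tempered
    -- distributions is injective.
    have h0 : g - (memLp_testFunction ψ hr).toLp ∈
        (Lp.toTemperedDistributionCLM ℂ (volume : Measure (Rn n)) ∞).ker := by
      rw [LinearMap.mem_ker, ContinuousLinearMap.coe_coe, map_sub, sub_eq_zero]
      exact hg
    rw [Lp.ker_toTemperedDistributionCLM_eq_bot, Submodule.mem_bot, sub_eq_zero] at h0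
    exact h0
  rw [hg', Lp.enorm_toLp]
  refine le_trans (le_of_eq ?_) ((continuous_testFunction ψ hr).enorm_le_eLpNorm_top 0)
  have h1 : testFunction ψ r 0 = ((∫ η : Rn n, bracket η ^ (-r) : ℝ) : ℂ) := by
    rw [testFunction, hψ, one_mul, ← integral_complex_ofReal]
    simp
  have h2 : ∀ η : Rn n, 0 ≤ bracket η ^ (-r) := fun η => by have := bracket_pos η; positivity
  rw [h1, ← ofReal_norm, Complex.norm_real, Real.norm_of_nonneg (integral_nonneg h2),
    ofReal_integral_eq_lintegral_ofReal (integrable_bracket_rpow hr) (.of_forall h2)]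
  congr 1
  ext η
  exact Real.enorm_of_nonneg (h2 η)

/-- The test function superposes modulations of `ψ`, so by Fubini its pairing is a frequency
convolution of the STFT of `ψ` with `⟨η⟩^{-r}`. -/
theorem testDistribution_modTranslate (ψ v : 𝓢(Rn n, ℂ)) {r : ℝ} (hr : n < r) (x ξ : Rn n) :
    testDistribution ψ hr (modTranslate v x ξ) =
      ∫ η, crossSTFT ψ v x (ξ - η) * ((bracket η ^ (-r) : ℝ) : ℂ) := by
  rw [testDistribution_apply]
  have e1 : ∀ t, modTranslate v x ξ t * testFunction ψ r t =
      ∫ η, ψ t * modTranslate v x (ξ - η) t * ((bracket η ^ (-r) : ℝ) : ℂ) := by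
    intro t
    rw [testFunction, ← integral_const_mul, ← integral_const_mul]
    congr 1
    ext η
    rw [modTranslate_apply, modTranslate_apply, inner_sub_right]
    have : Complex.exp (-Complex.I * ((inner ℝ t ξ - inner ℝ t η : ℝ) : ℂ)) =
        Complex.exp (-Complex.I * ((inner ℝ t ξ : ℝ) : ℂ)) *
          Complex.exp (((inner ℝ t η : ℝ) : ℂ) * Complex.I) := by
      rw [← Complex.exp_add]
      congr 1
      push_cast
      ring
    rw [this]
    ring
  have e2 : ∀ η, crossSTFT ψ v x (ξ - η) * ((bracket η ^ (-r) : ℝ) : ℂ) =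
      ∫ t, ψ t * modTranslate v x (ξ - η) t * ((bracket η ^ (-r) : ℝ) : ℂ) := fun η =>
    (integral_mul_const _ _).symm
  simp only [e1, e2]
  refine integral_integral_swap ?_
  have hc : Continuous fun z : Rn n × Rn n =>
      ψ z.1 * modTranslate v x (ξ - z.2) z.1 * ((bracket z.2 ^ (-r) : ℝ) : ℂ) := by
    simp only [modTranslate_apply]
    have h1 : Continuous fun z : Rn n × Rn n => ψ z.1 := ψ.continuous.comp continuous_fst
    have h2 : Continuous fun z : Rn n × Rn n => v (z.1 - x) := v.continuous.comp (by fun_prop)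
    have h3 : Continuous fun z : Rn n × Rn n => bracket z.2 ^ (-r) :=
      (continuous_bracket_rpow (-r)).comp continuous_snd
    exact (h1.mul ((by fun_prop : Continuous fun z : Rn n × Rn n =>
      Complex.exp (-Complex.I * ((inner ℝ z.1 (ξ - z.2) : ℝ) : ℂ))).mul h2)).mul
        (Complex.continuous_ofReal.comp h3)
  have hb : Integrable fun z : Rn n × Rn n =>
      (‖ψ z.1‖ * SchwartzMap.seminorm ℝ 0 0 v) * bracket z.2 ^ (-r) :=
    Integrable.mul_prod ((ψ.integrable (μ := volume)).norm.mul_const _) (integrable_bracket_rpow hr)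
  refine hb.mono' hc.aestronglyMeasurable (.of_forall fun z => ?_)
  have := bracket_pos z.2
  change ‖ψ z.1 * modTranslate v x (ξ - z.2) z.1 * ((bracket z.2 ^ (-r) : ℝ) : ℂ)‖ ≤ _
  rw [norm_mul, norm_mul, norm_modTranslate, Complex.norm_real,
    Real.norm_of_nonneg (by positivity)]
  gcongr
  exact SchwartzMap.norm_le_seminorm ℝ v _

theorem exists_norm_stft_testDistribution_le (φ ψ : 𝓢(Rn n, ℂ)) :
    ∃ C : ℝ, 0 ≤ C ∧ ∀ (r : ℝ) (hr : n < r), r ≤ n + 1 → ∀ x ξ,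
      ‖stft φ (testDistribution ψ hr) x ξ‖ ≤ C * decayWeight (n + 1) x * bracket ξ ^ (-r) := by
  obtain ⟨C, hC, hdec⟩ := norm_crossSTFT_le_decayWeight ψ (conjWindow φ) (2 * (n + 1))
  set c : ℝ := (2 * Real.pi) ^ (-(n : ℝ) / 2) with hc
  have hc0 : 0 < c := by positivity
  set D : ℝ := ∫ x : Rn n, decayWeight (n + 1) x with hD
  have hD0 : 0 ≤ D := integral_nonneg fun x => (decayWeight_pos _ _).le
  refine ⟨c * (C * D), by positivity, fun r hr hr1 x ξ => ?_⟩
  have hr0 : 0 ≤ r := (Nat.cast_nonneg n).trans hr.le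
  have hint : Integrable fun η : Rn n => decayWeight (n + 1) (ξ - η) :=
    (integrable_decayWeight (Nat.lt_succ_self n)).comp_sub_left ξ
  have hle : decayWeight (2 * (n + 1)) x ≤ decayWeight (n + 1) x := by
    have := norm_nonneg x
    refine inv_anti₀ (by positivity) (pow_le_pow_right₀ (by linarith) (by omega))
  rw [stft, shiftedWindow_eq_modTranslate, testDistribution_modTranslate, norm_mul,
    Complex.norm_real, Real.norm_of_nonneg hc0.le]
  have h1 : ∀ η : Rn n, ‖crossSTFT ψ (conjWindow φ) x (ξ - η) * ((bracket η ^ (-r) : ℝ) : ℂ)‖ ≤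
      (C * decayWeight (n + 1) x * bracket ξ ^ (-r)) * decayWeight (n + 1) (ξ - η) := by
    intro η
    have hη := bracket_pos η
    have hx := decayWeight_pos (n + 1) x
    have hx2 := decayWeight_pos (2 * (n + 1)) x
    have hd := decayWeight_pos (2 * (n + 1)) (ξ - η)
    rw [norm_mul, Complex.norm_real, Real.norm_of_nonneg (by positivity)]
    calc _ ≤ (C * (decayWeight (2 * (n + 1)) x * decayWeight (2 * (n + 1)) (ξ - η))) *
          bracket η ^ (-r) := by gcongr; exact hdec _ _
      _ ≤ (C * (decayWeight (n + 1) x * decayWeight (2 * (n + 1)) (ξ - η))) *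
          bracket η ^ (-r) := by gcongr
      _ = C * decayWeight (n + 1) x * (bracket η ^ (-r) * decayWeight (2 * (n + 1)) (ξ - η)) := by
          ring
      _ ≤ C * decayWeight (n + 1) x * (bracket ξ ^ (-r) * decayWeight (n + 1) (ξ - η)) := by
          exact mul_le_mul_of_nonneg_left (bracket_rpow_neg_mul_decayWeight_le hr0 hr1 ξ η)
            (by positivity)
      _ = _ := by ring
  have h2 := norm_integral_le_of_norm_le (hint.const_mul _) (.of_forall h1)
  rw [integral_const_mul, integral_sub_left_eq_self (decayWeight (n + 1)) volume ξ] at h2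
  calc _ ≤ c * (C * decayWeight (n + 1) x * bracket ξ ^ (-r) * D) := by gcongr
    _ = _ := by ring

theorem exists_modNorm_testDistribution_le (φ ψ : 𝓢(Rn n, ℂ)) (s : ℝ) {p : ℝ≥0∞} (hp : 1 ≤ p)
    (q : ℝ≥0∞) :
    ∃ C : ℝ≥0∞, C ≠ ∞ ∧ ∀ (r : ℝ) (hr : n < r), r ≤ n + 1 →
      modNorm φ s p q (testDistribution ψ hr) ≤
        C * eLpNorm (fun ξ : Rn n => bracket ξ ^ (s - r)) q volume := by
  obtain ⟨C, hC, h⟩ := exists_norm_stft_testDistribution_le φ ψ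
  set A := eLpNorm (decayWeight (n := n) (n + 1)) p volume with hA
  have hAtop : A ≠ ∞ := (eLpNorm_decayWeight_lt_top (Nat.lt_succ_self n) hp).ne
  have hCA : ENNReal.ofReal C * A ≠ ∞ := ENNReal.mul_ne_top ENNReal.ofReal_ne_top hAtop
  refine ⟨ENNReal.ofReal C * A, hCA, fun r hr hr1 => ?_⟩
  have h1 : ∀ ξ, stftNorm φ p (testDistribution ψ hr) ξ ≤
      ENNReal.ofReal C * A * ‖bracket ξ ^ (-r)‖ₑ := by
    intro ξ
    have hξ := bracket_pos ξ
    calc _ ≤ eLpNorm ((C * bracket ξ ^ (-r)) • decayWeight (n := n) (n + 1)) p volume := by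
          refine eLpNorm_mono_real fun x => ?_
          refine (h r hr hr1 x ξ).trans_eq ?_
          simp only [Pi.smul_apply, smul_eq_mul]
          ring
      _ = _ := by
          rw [eLpNorm_const_smul, enorm_mul, Real.enorm_of_nonneg hC, hA]
          ring
  rw [modNorm_eq]
  have h2 : eLpNorm (fun ξ : Rn n => (ENNReal.ofReal C * A) * ‖bracket ξ ^ (s - r)‖ₑ) q volume =
      (ENNReal.ofReal C * A) * eLpNorm (fun ξ : Rn n => bracket ξ ^ (s - r)) q volume := by
    -- Homogeneity of `eLpNorm` is applied to a real scalar, so the finite constant is first written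
    -- as a nonnegative real.
    obtain ⟨K, hK⟩ := WithTop.ne_top_iff_exists.1 hCA
    replace hK : (K : ℝ≥0∞) = ENNReal.ofReal C * A := hK
    rw [← hK]
    have := eLpNorm_const_smul (K : ℝ) (fun ξ : Rn n => bracket ξ ^ (s - r)) q volume
    rw [← eLpNorm_enorm] at this
    simp only [Pi.smul_apply, enorm_smul] at this
    have hKe : ‖(K : ℝ)‖ₑ = (K : ℝ≥0∞) :=
      (Real.enorm_of_nonneg K.coe_nonneg).trans ENNReal.ofReal_coe_nnreal
    rwa [hKe] at this
  rw [← h2]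
  refine eLpNorm_mono_enorm fun ξ => ?_
  simp only [enorm_eq_self]
  calc _ ≤ ‖bracket ξ ^ s‖ₑ * (ENNReal.ofReal C * A * ‖bracket ξ ^ (-r)‖ₑ) := by
        gcongr
        exact h1 ξ
    _ = (ENNReal.ofReal C * A) * (‖bracket ξ ^ s‖ₑ * ‖bracket ξ ^ (-r)‖ₑ) := by ring
    _ = _ := by rw [← enorm_mul, ← Real.rpow_add (bracket_pos ξ), sub_eq_add_neg]

theorem lintegral_bracket_rpow_neg_eq_top (hn : 0 < n) :
    ∫⁻ ξ : Rn n, ‖bracket ξ ^ (-(n : ℝ))‖ₑ = ∞ := by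
  by_contra hne
  have : Nonempty (Fin n) := ⟨⟨0, hn⟩⟩
  have hint : Integrable (fun ξ : Rn n => (fun y : ℝ => Real.sqrt (1 + y ^ 2) ^ (-(n : ℝ))) ‖ξ‖) :=
    ⟨(continuous_bracket_rpow _).aestronglyMeasurable, lt_top_iff_ne_top.2 hne⟩
  replace hint := (integrable_fun_norm_addHaar (volume : Measure (Rn n))
    (f := fun y : ℝ => Real.sqrt (1 + y ^ 2) ^ (-(n : ℝ)))).1 hint
  rw [finrank_euclideanSpace_fin] at hint
  -- In polar coordinates the radial integrand is at least `2^{-n} y^{-1}` for `y > 1`, since there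
  -- `⟨y⟩ ≤ 2y`.
  have h1 : IntegrableOn (fun y : ℝ => (2 : ℝ) ^ (-(n : ℝ)) * y ^ (-1 : ℝ)) (Set.Ioi 1) := by
    refine (hint.mono_set (Set.Ioi_subset_Ioi zero_le_one)).mono' ?_ ?_
    · refine ContinuousOn.aestronglyMeasurable ?_ measurableSet_Ioi
      exact continuousOn_const.mul
        (continuousOn_id.rpow_const fun y hy => .inl (zero_lt_one.trans hy).ne')
    · filter_upwards [ae_restrict_mem measurableSet_Ioi] with y hy
      have hy1 : 1 < y := hy
      have hy0 : 0 < y := zero_lt_one.trans hy1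
      have h2 : Real.sqrt (1 + y ^ 2) ≤ 2 * y :=
        Real.sqrt_le_iff.2 ⟨by positivity, by nlinarith⟩
      have h3 : (2 * y) ^ (-(n : ℝ)) ≤ Real.sqrt (1 + y ^ 2) ^ (-(n : ℝ)) :=
        Real.rpow_le_rpow_of_nonpos (by positivity) h2 (by simp)
      rw [Real.norm_of_nonneg (by positivity), smul_eq_mul]
      refine le_trans (le_of_eq ?_) (mul_le_mul_of_nonneg_left h3 (by positivity))
      rw [Real.mul_rpow two_pos.le hy0.le, mul_left_comm, ← Real.rpow_natCast,
        ← Real.rpow_add hy0]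
      congr 2
      rw [Nat.cast_sub hn]
      push_cast
      ring
  have h4 : IntegrableOn (fun y : ℝ => y ^ (-1 : ℝ)) (Set.Ioi 1) := by
    refine IntegrableOn.congr_fun (h1.const_mul ((2 : ℝ) ^ (-(n : ℝ)))⁻¹) (fun y _ => ?_) measurableSet_Ioi
    exact inv_mul_cancel_left₀ (by positivity) _
  exact lt_irrefl _ ((integrableOn_Ioi_rpow_iff zero_lt_one).1 h4)

/-- Fatou along `r k = n + 1 / (k + 1)`: a uniform bound would pass to the divergent integral at the
exponent `n`. -/
theorem exists_lt_lintegral_bracket_rpow (hn : 0 < n) {B : ℝ≥0∞} (hB : B ≠ ∞) :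
    ∃ r : ℝ, n < r ∧ r ≤ n + 1 ∧ B < ∫⁻ ξ : Rn n, ‖bracket ξ ^ (-r)‖ₑ := by
  by_contra! hcon
  let r : ℕ → ℝ := fun k => n + 1 / ((k : ℝ) + 1)
  have hr (k : ℕ) : ∫⁻ ξ : Rn n, ‖bracket ξ ^ (-(r k))‖ₑ ≤ B := by
    refine hcon (r k) (lt_add_of_pos_right _ Nat.one_div_pos_of_nat) ?_
    refine add_le_add le_rfl ?_
    rw [div_le_one (by positivity)]
    linarith [(Nat.cast_nonneg k : (0 : ℝ) ≤ k)]
  have hlim : Filter.Tendsto r Filter.atTop (nhds (n : ℝ)) := by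
    have h := (tendsto_one_div_add_atTop_nhds_zero_nat (𝕜 := ℝ)).const_add (n : ℝ)
    rwa [add_zero] at h
  have h1 : ∀ ξ : Rn n, Filter.liminf (fun k => ‖bracket ξ ^ (-(r k))‖ₑ) Filter.atTop =
      ‖bracket ξ ^ (-(n : ℝ))‖ₑ := by
    intro ξ
    refine Filter.Tendsto.liminf_eq ?_
    refine (continuous_enorm.tendsto _).comp ?_
    exact ((Real.continuous_const_rpow (bracket_pos ξ).ne').tendsto _).comp hlim.neg
  have h2 := lintegral_liminf_le (μ := (volume : Measure (Rn n))) (u := Filter.atTop)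
    (f := fun k ξ => ‖bracket ξ ^ (-(r k))‖ₑ)
    fun k => (continuous_bracket_rpow _).measurable.enorm
  simp only [h1] at h2
  rw [lintegral_bracket_rpow_neg_eq_top hn, top_le_iff] at h2
  have h3 : Filter.liminf (fun k => ∫⁻ ξ : Rn n, ‖bracket ξ ^ (-(r k))‖ₑ) Filter.atTop ≤ B :=
    Filter.liminf_le_of_frequently_le' (.of_forall hr)
  rw [h2] at h3
  exact hB (top_le_iff.1 h3)

end ModulationSpace

/-! ### Necessity: contradiction as `r` decreases to `n` -/

namespace ModulationSpace

variable {n : ℕ}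

theorem exists_schwartz_apply_zero_eq_one {φ : 𝓢(Rn n, ℂ)} (hφ : φ ≠ 0) :
    ∃ ψ : 𝓢(Rn n, ℂ), ψ 0 = 1 := by
  obtain ⟨t, ht⟩ : ∃ t, φ t ≠ 0 := by
    by_contra! h
    exact hφ (SchwartzMap.ext h)
  refine ⟨(φ t)⁻¹ • SchwartzMap.compSubConstCLM ℝ (-t) φ, ?_⟩
  change (φ t)⁻¹ * φ (0 - -t) = 1
  rw [zero_sub, neg_neg, inv_mul_cancel₀ ht]

/-- `I ≤ C I^a` with `a < 1` forces a bound on a finite number `I`. -/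
theorem le_rpow_of_le_mul_rpow {I C : ℝ≥0∞} {a : ℝ} (ha : a < 1) (hI : I ≠ ∞)
    (h : I ≤ C * I ^ a) : I ≤ C ^ (1 - a)⁻¹ := by
  rcases eq_or_ne I 0 with rfl | hI0
  · exact zero_le
  have h1 : I ^ (1 - a) ≤ C := by
    rw [ENNReal.rpow_sub _ _ hI0 hI, ENNReal.rpow_one]
    exact ENNReal.div_le_of_le_mul h
  calc I = (I ^ (1 - a)) ^ (1 - a)⁻¹ := by
        rw [← ENNReal.rpow_mul, mul_inv_cancel₀ (by linarith), ENNReal.rpow_one]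
    _ ≤ _ := ENNReal.rpow_le_rpow h1 (inv_nonneg.2 (by linarith))

/-- With `s ≤ n (1 - 1/q)` the exponent satisfies `(s - r) q ≤ (n - r) q - n ≤ -r`, the last step
because `n - r < 0` and `q ≥ 1`. -/
theorem eLpNorm_bracket_rpow_le {s r : ℝ} {q : ℝ≥0∞} (hq : 1 ≤ q) (hq' : q ≠ ∞) (hr : n < r)
    (hs : s ≤ n * (1 - q.toReal⁻¹)) :
    eLpNorm (fun ξ : Rn n => bracket ξ ^ (s - r)) q volume ≤
      (∫⁻ ξ : Rn n, ‖bracket ξ ^ (-r)‖ₑ) ^ q.toReal⁻¹ := by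
  have hq0 : q ≠ 0 := (one_pos.trans_le hq).ne'
  have hq1 : 1 ≤ q.toReal := by
    rw [← ENNReal.toReal_one]
    exact ENNReal.toReal_mono hq' hq
  rw [eLpNorm_eq_lintegral_rpow_enorm_toReal hq0 hq', one_div]
  refine ENNReal.rpow_le_rpow (lintegral_mono fun ξ => ?_) (by positivity)
  rw [enorm_bracket_rpow, enorm_bracket_rpow, ← ENNReal.rpow_mul]
  refine ENNReal.rpow_le_rpow_of_exponent_le (ENNReal.one_le_ofReal.2 (one_le_bracket ξ)) ?_
  have h1 : (s - r) * q.toReal ≤ (n * (1 - q.toReal⁻¹) - r) * q.toReal := by gcongr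
  have h2 : (n * (1 - q.toReal⁻¹) - r) * q.toReal = (n - r) * q.toReal - n := by
    field_simp
    ring
  nlinarith

/-- The test distributions are unbounded in `L_∞` relative to the modulation norm unless `s` is
large. -/
theorem not_continuouslyEmbeds_linftyNorm (hn : 0 < n) {φ : 𝓢(Rn n, ℂ)} (hφ : φ ≠ 0) {s : ℝ}
    {p q q' : ℝ≥0∞} (hp : 1 ≤ p) (hq : 1 ≤ q) (hq' : 1 / q + 1 / q' = 1)
    (h : ¬((0 ≤ s ∧ q = 1) ∨ (n : ℝ) * (1 / q').toReal < s)) :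
    ¬ContinuouslyEmbeds (modNorm φ s p q) linftyNorm := by
  rintro ⟨K, hK⟩
  push Not at h
  obtain ⟨hs1, hs2⟩ := h
  obtain ⟨ψ, hψ⟩ := exists_schwartz_apply_zero_eq_one hφ
  obtain ⟨C, hC, hmod⟩ := exists_modNorm_testDistribution_le φ ψ s hp q
  have hconj : (1 / q').toReal = 1 - q.toReal⁻¹ := by
    have h1 : 1 / q ≤ 1 := by rw [one_div]; exact ENNReal.inv_le_one.2 hq
    have h2 : 1 / q' = 1 - 1 / q :=
      (ENNReal.sub_eq_of_eq_add (h1.trans_lt ENNReal.one_lt_top).ne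
        (hq'.symm.trans (add_comm _ _))).symm
    rw [h2, ENNReal.toReal_sub_of_le h1 ENNReal.one_ne_top, ENNReal.toReal_one, one_div,
      ENNReal.toReal_inv]
  rw [hconj] at hs2
  have key : ∀ r : ℝ, n < r → r ≤ n + 1 →
      eLpNorm (fun ξ : Rn n => bracket ξ ^ (s - r)) q volume < ∞ →
      ∫⁻ ξ : Rn n, ‖bracket ξ ^ (-r)‖ₑ ≤
        K * C * eLpNorm (fun ξ : Rn n => bracket ξ ^ (s - r)) q volume := by
    intro r hr hr1 hfin
    have h1 := hmod r hr hr1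
    have h2 := h1.trans_lt (ENNReal.mul_lt_top hC.lt_top hfin)
    calc _ ≤ linftyNorm (testDistribution ψ hr) := linftyNorm_testDistribution_ge hψ hr
      _ ≤ K * modNorm φ s p q (testDistribution ψ hr) := hK _ h2
      _ ≤ _ := by rw [mul_assoc]; gcongr
  have hKC : (K : ℝ≥0∞) * C ≠ ∞ := ENNReal.mul_ne_top ENNReal.coe_ne_top hC
  rcases eq_or_ne q ∞ with rfl | hqtop
  -- For `q = ∞` the condition reads `s ≤ n < r`, so the weight norm is at most `1` while the
  -- integral exceeds every bound.
  · obtain ⟨r, hr, hr1, hlt⟩ := exists_lt_lintegral_bracket_rpow hn hKC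
    have hs : s - r ≤ 0 := by
      simp only [ENNReal.toReal_top, inv_zero, sub_zero, mul_one] at hs2
      linarith
    have h1 := eLpNorm_top_bracket_rpow_le_one (n := n) hs
    refine (hlt.trans_le (key r hr hr1 (h1.trans_lt ENNReal.one_lt_top))).not_ge ?_
    exact mul_le_of_le_one_right' h1
  have hbound : ∀ r : ℝ, n < r → r ≤ n + 1 →
      ∫⁻ ξ : Rn n, ‖bracket ξ ^ (-r)‖ₑ ≤
        K * C * (∫⁻ ξ : Rn n, ‖bracket ξ ^ (-r)‖ₑ) ^ q.toReal⁻¹ := by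
    intro r hr hr1
    have h1 := eLpNorm_bracket_rpow_le hq hqtop hr hs2
    have h2 := ENNReal.rpow_lt_top_of_nonneg (inv_nonneg.2 (ENNReal.toReal_nonneg (a := q)))
      (lintegral_bracket_rpow_lt_top hr).ne
    exact (key r hr hr1 (h1.trans_lt h2)).trans (by gcongr)
  rcases eq_or_ne q 1 with rfl | hq1
  -- For `q = 1` the power `I^{1/q}` gives nothing; instead `s < 0` makes `⟨ξ⟩^{-(n-s)}` an
  -- integrable majorant of `⟨ξ⟩^{s-r}` that does not depend on `r`.
  · have hs : s < 0 := lt_of_not_ge fun h => hs1 h rfl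
    have hfin := (lintegral_bracket_rpow_lt_top (n := n) (r := n - s) (by linarith)).ne
    obtain ⟨r, hr, hr1, hlt⟩ := exists_lt_lintegral_bracket_rpow hn (ENNReal.mul_ne_top hKC hfin)
    have h1 : eLpNorm (fun ξ : Rn n => bracket ξ ^ (s - r)) 1 volume ≤
        ∫⁻ ξ : Rn n, ‖bracket ξ ^ (-(n - s))‖ₑ := by
      rw [eLpNorm_one_eq_lintegral_enorm]
      refine lintegral_mono fun ξ => ?_
      rw [enorm_bracket_rpow, enorm_bracket_rpow]
      exact ENNReal.rpow_le_rpow_of_exponent_le (ENNReal.one_le_ofReal.2 (one_le_bracket ξ))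
        (by linarith)
    refine (hlt.trans_le (key r hr hr1 (h1.trans_lt hfin.lt_top))).not_ge ?_
    gcongr
  -- For `1 < q < ∞` the sublinear inequality `I ≤ K C I^{1/q}` bounds `I` by a constant, which a
  -- suitable `r` violates.
  · have ha : q.toReal⁻¹ < 1 := by
      refine inv_lt_one_of_one_lt₀ ?_
      rw [← ENNReal.toReal_one, ENNReal.toReal_lt_toReal ENNReal.one_ne_top hqtop]
      exact lt_of_le_of_ne hq hq1.symm
    obtain ⟨r, hr, hr1, hlt⟩ := exists_lt_lintegral_bracket_rpow (n := n) hn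
      (B := (K * C) ^ (1 - q.toReal⁻¹)⁻¹)
      (ENNReal.rpow_ne_top_of_nonneg (inv_nonneg.2 (by linarith)) hKC)
    exact hlt.not_ge (le_rpow_of_le_mul_rpow ha (lintegral_bracket_rpow_lt_top hr).ne
      (hbound r hr hr1))

end ModulationSpace

end

theorem corollary2p7 (n : ℕ) (hn : 0 < n) (φ : 𝓢(ModulationSpace.Rn n, ℂ)) (hφ : φ ≠ 0)
    (s : ℝ) (p q q' : ℝ≥0∞) (hp : 1 ≤ p) (hq : 1 ≤ q) (hq' : 1 / q + 1 / q' = 1) :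
    List.TFAE [
      ModulationSpace.ContinuouslyEmbeds (ModulationSpace.modNorm φ s p q)
        ModulationSpace.linftyNorm,
      ModulationSpace.ContinuouslyEmbeds (ModulationSpace.modNorm φ s p q)
        ModulationSpace.cubNorm,
      ModulationSpace.ContinuouslyEmbeds (ModulationSpace.modNorm φ s p q)
        (ModulationSpace.modNorm φ 0 ∞ 1),
      (0 ≤ s ∧ q = 1) ∨ (n : ℝ) * (1 / q').toReal < s] := by
  tfae_have 4 → 3 := ModulationSpace.continuouslyEmbeds_modNorm_zero_top_one hφ hp hq'
  tfae_have 3 → 2 := by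
    rintro ⟨K, hK⟩
    obtain ⟨C, hC, h⟩ := ModulationSpace.exists_cubNorm_le hφ
    refine ⟨C.toNNReal * K, fun f hf => ?_⟩
    have h1 := hK f hf
    have h2 := h1.trans_lt (ENNReal.mul_lt_top ENNReal.coe_lt_top hf)
    rw [ENNReal.coe_mul, ENNReal.coe_toNNReal hC, mul_assoc]
    exact (h f h2).trans (by gcongr)
  tfae_have 2 → 1 := by
    rintro ⟨K, hK⟩
    exact ⟨K, fun f hf => (ModulationSpace.linftyNorm_le_cubNorm f).trans (hK f hf)⟩
  tfae_have 1 → 4 := fun h => by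
    by_contra hcon
    exact ModulationSpace.not_continuouslyEmbeds_linftyNorm hn hφ hp hq hq' hcon h
  tfae_finish
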